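/- **Setting.** Simplicial complexes are abstract, non-empty, connected and locally finite. Let $G$ be a totally disconnected locally compact Hausdorff topological group, and let $\mathcal X$ be a $G$-complex: a simplicial complex on which $G$ acts faithfully by automorphisms such that the stabilizer of every non-empty cell is compact and open in $G$. Assume that $\mathcal X$ is almost transitive, i.e. that $G\backslash\mathcal X$ is finite. For a subgroup $\Gamma\le G$ write $\Gamma\le_{\mathcal X}G$ if the partially ordered set $\Gamma\backslash\mathcal X$ is a simplicial complex and the projection $p_\Gamma:\mathcal X\to\Gamma\backslash\mathcal X$ is a cover map. Let $\mathscr C=\mathscr C(G,\mathcal X)$ be the category with objects $\Gamma\backslash\mathcal X$, $\Gamma\le_{\mathcal X}G$ (with $1\backslash\mathcal X=\mathcal X$), whose morphisms are the maps $p_\Gamma\circ g:\mathcal X\to\Gamma\backslash\mathcal X$ ($g\in G$), and the projections $\Gamma'\backslash\mathcal X\to\Gamma\backslash\mathcal X$ for $1\ne\Gamma'\le\Gamma$. Let $\mathtt{pHil}$ be the category of complex pre-Hilbert spaces and (not necessarily continuous) linear maps. For a set $X$ let $\tilde\ell^2(X)$ be the pre-Hilbert space of finitely supported functions on $X$, which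 is functorial via $(f_*\varphi)(y)=\sum_{f(x)=y}\varphi(x)$. A functor $F:\mathscr C\to\mathtt{pHil}$ is *elementary* if there is a functor $S:\mathscr C\to\mathtt{Set}$ such that (E1) $F$ is unitarily naturally isomorphic to $\tilde\ell^2\circ S$; (E2) for $x\in S\mathcal X$ the group $\mathrm{Stab}_G(x)$ is compact and open, and is contained in the stabilizer of a non-empty cell of $\mathcal X$; (E3) for all $\Gamma\le_{\mathcal X}G$ the map $\Gamma\backslash S\mathcal X\to S(\Gamma\backslash\mathcal X)$, $\Gamma x\mapsto (Sp_\Gamma)x$, is bijective; (E4) $G\backslash S\mathcal X$ is finite. $F$ is *semi-elementary* if $F\oplus F'$ (orthogonal sum) is elementary for some functor $F':\mathscr C\to\mathtt{pHil}$. A *$(\mathscr C,F)$-operator* is a natural transformation $a=\{a_X\}:F\to F$ for which there is a natural transformation $a^*=\{a^*_X\}:F\to F$ with $\langle a_Xu,v\rangle=\langle u,a^*_Xv\rangle$. These form a unital $*$-algebra. An *algebra of $(\mathscr C,F)$-operators* is a $*$-subalgebra $A$ (not necessarily unital) that is idempotented: for every finite $s\subseteq A$ there is $e=e^2=e^*\in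 A$ with $eae=a$ for all $a\in s$. A *unitary representation* of $A$ is a Hilbert space $V$ on which $A$ acts by bounded operators, with $\langle au,v\rangle=\langle u,a^*v\rangle$ and $AV$ dense. It is irreducible if $V\neq0$ and $V$ has no closed $A$-submodules other than $0$ and $V$. Put $\varphi_{V,v}(a)=\langle av,v\rangle$. For $V$ irreducible and $V'$ unitary, $V\prec V'$ means that for every unit vector $v\in V$, every $\varepsilon>0$ and every finite $s\subseteq A$ there is a unit vector $v'\in V'$ with $|\varphi_{V,v}(a)-\varphi_{V',v'}(a)|<\varepsilon$ for all $a\in s$. The *unitary dual* $\widehat A$ is the set of unitary isomorphism classes of irreducible unitary representations of $A$, with the topology having as a subbasis the sets $N_{V,v,\varepsilon,s}$ ($V$ irreducible, $v\in V$ a unit vector, $\varepsilon>0$, $s\subseteq A$ finite) of all $[U]$ for which there is $u\in U$ with $|\varphi_{V,v}(a)-\varphi_{U,u}(a)|<\varepsilon$ for all $a\in s$. If $A$ acts on $FX$ by bounded operators, put $\mathrm{Spec}_A(X)=\{[V]\in\widehat A : V\prec\overline{A\cdot FX}\}$, where $\overline{A\cdot FX}$ is the Hilbert space completion of $A\cdot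 FX$ with the extended $A$-action. For non-empty cells $x\ne y$ of $\mathcal X$, $\mathrm{dist}(x,y)$ is the least $t$ for which there are cells $y_1,\dots,y_t$ with $x\subseteq y_1$, $y\subseteq y_t$ and $y_i\cap y_{i+1}\ne\emptyset$ for $1\le i<t$; also $\mathrm{dist}(x,x)=0$. The ball $\mathrm B_{\mathcal X}(v,n)$ is the set of cells at distance at most $n$ from $v$. **Theorem.** Let $\mathcal X$ be an almost transitive $G$-complex, $\mathscr C=\mathscr C(G,\mathcal X)$, $F:\mathscr C\to\mathtt{pHil}$ a semi-elementary functor, $A$ an algebra of $(\mathscr C,F)$-operators, and $\{\Gamma_\alpha\}_{\alpha\in I}$ a family of subgroups of $G$ with $\Gamma_\alpha\le_{\mathcal X}G$ for all $\alpha\in I$. The following two conditions are equivalent: 1. for every compact $C\subseteq G$ with $1\in C$ there are $\alpha\in I$ and $g\in G$ such that $C\cap g^{-1}\Gamma_\alpha g=\{1\}$; 2. for every $n\in\mathbb N$ there are $\alpha\in I$ and a vertex $v$ of $\mathcal X$ such that the quotient map $\mathcal X\to\Gamma_\alpha\backslash\mathcal X$ is injective on the ball $\mathrm B_{\mathcal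 X}(v,n)$. Moreover, $A$ acts by bounded operators on $FX$ for every $X\in\mathscr C$ (so that all the spectra are defined), and if one of the conditions (1), (2) holds, then $$\overline{\bigcup_{\alpha\in I}\mathrm{Spec}_A(\Gamma_\alpha\backslash\mathcal X)}\supseteq\mathrm{Spec}_A(\mathcal X),$$ where the closure is taken in $\widehat A$. -/

import Mathlib

open CategoryTheory

universe u v w

noncomputable section

/-! ## Representations of star-algebras -/

section Representations

/-- A `*`-algebra is idempotented if every finite subset `s` is contained in `e A e` for some
self-adjoint idempotent `e`. -/
def IsIdempotented (A : Type u) [NonUnitalRing A] [StarRing A] : Prop :=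
  ∀ s : Finset A, ∃ e : A, IsStarProjection e ∧ ∀ a ∈ s, e * a * e = a

variable (A : Type u) [NonUnitalRing A] [Module ℂ A] [StarRing A]

/-- A unitary representation of `A`: a Hilbert space on which `A` acts by bounded operators,
`⟨a u, v⟩ = ⟨u, a* v⟩`, and such that the span `AV` of the vectors `a v` is dense. -/
structure UnitaryRep where
  carrier : Type u
  [normed : NormedAddCommGroup carrier]
  [innerProduct : InnerProductSpace ℂ carrier]
  [complete : CompleteSpace carrier]
  act : A →ₙₐ[ℂ] (carrier →L[ℂ] carrier)
  inner_act : ∀ a x y, inner ℂ (act a x) y = inner ℂ x (act (star a) y)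
  dense_act : Dense (Submodule.span ℂ {x : carrier | ∃ a y, act a y = x} : Set carrier)

attribute [instance] UnitaryRep.normed UnitaryRep.innerProduct UnitaryRep.complete

/-- A pre-unitary representation of `A`: a pre-Hilbert space on which `A` acts by operators that
are bounded, with `⟨a u, v⟩ = ⟨u, a* v⟩`, and such that `AV = V`. -/
structure PreUnitaryRep where
  carrier : Type u
  [normed : NormedAddCommGroup carrier]
  [innerProduct : InnerProductSpace ℂ carrier]
  act : A →ₙₐ[ℂ] Module.End ℂ carrier
  bounded_act : ∀ a, ∃ M : ℝ, ∀ x, ‖act a x‖ ≤ M * ‖x‖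
  inner_act : ∀ a x y, inner ℂ (act a x) y = inner ℂ x (act (star a) y)
  smooth_act : Submodule.span ℂ {x : carrier | ∃ a y, act a y = x} = ⊤

attribute [instance] PreUnitaryRep.normed PreUnitaryRep.innerProduct

variable {A}

/-- The bounded operator by which `a` acts on a pre-unitary representation. -/
def PreUnitaryRep.actL (V : PreUnitaryRep A) (a : A) : V.carrier →L[ℂ] V.carrier :=
  (V.act a).mkContinuousOfExistsBound (V.bounded_act a)

theorem PreUnitaryRep.actL_apply (V : PreUnitaryRep A) (a : A) (x : V.carrier) :
    V.actL a x = V.act a x := rfl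

/-- The continuous extension of `actL a` to the completion. -/
def PreUnitaryRep.actC (V : PreUnitaryRep A) (a : A) :
    UniformSpace.Completion V.carrier →L[ℂ] UniformSpace.Completion V.carrier :=
  (V.actL a).completion

theorem PreUnitaryRep.actC_coe (V : PreUnitaryRep A) (a : A) (x : V.carrier) :
    V.actC a (x : UniformSpace.Completion V.carrier) =
      ((V.act a x : V.carrier) : UniformSpace.Completion V.carrier) :=
  ContinuousLinearMap.completion_apply_coe (V.actL a) x

theorem PreUnitaryRep.ext_completion (V : PreUnitaryRep A)
    {S T : UniformSpace.Completion V.carrier →L[ℂ] UniformSpace.Completion V.carrier}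
    (h : ∀ x : V.carrier, S (x : UniformSpace.Completion V.carrier) = T x) : S = T := by
  refine ContinuousLinearMap.ext fun x => ?_
  exact congrFun (UniformSpace.Completion.denseRange_coe.equalizer S.continuous T.continuous
    (funext h)) x

/-- The extended action on the completion, as a homomorphism of algebras. -/
def PreUnitaryRep.actHom (V : PreUnitaryRep A) :
    A →ₙₐ[ℂ] (UniformSpace.Completion V.carrier →L[ℂ] UniformSpace.Completion V.carrier) where
  toFun := V.actC
  map_smul' c a := V.ext_completion fun x => by
    change V.actC (c • a) x = c • V.actC a x
    rw [V.actC_coe, V.actC_coe, map_smul, LinearMap.smul_apply, UniformSpace.Completion.coe_smul]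
  map_zero' := V.ext_completion fun x => by
    rw [V.actC_coe, map_zero, LinearMap.zero_apply, UniformSpace.Completion.coe_zero]
    rfl
  map_add' a b := V.ext_completion fun x => by
    change V.actC (a + b) x = V.actC a x + V.actC b x
    rw [V.actC_coe, V.actC_coe, V.actC_coe, map_add, LinearMap.add_apply,
      UniformSpace.Completion.coe_add]
  map_mul' a b := V.ext_completion fun x => by
    change V.actC (a * b) x = V.actC a (V.actC b x)
    rw [V.actC_coe, V.actC_coe, V.actC_coe, map_mul, Module.End.mul_apply]

/-- The completion of a pre-unitary representation, with the extended action. -/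
def PreUnitaryRep.completion (V : PreUnitaryRep A) : UnitaryRep A where
  carrier := UniformSpace.Completion V.carrier
  act := V.actHom
  inner_act a x y := by
    change inner ℂ (V.actC a x) y = inner ℂ x (V.actC (star a) y)
    induction x, y using UniformSpace.Completion.induction_on₂ with
    | hp =>
      exact isClosed_eq
        (UniformSpace.Completion.Continuous.inner ((V.actC a).continuous.comp continuous_fst)
          continuous_snd)
        (UniformSpace.Completion.Continuous.inner continuous_fst
          ((V.actC (star a)).continuous.comp continuous_snd))
    | ih x y =>
      rw [V.actC_coe, V.actC_coe, UniformSpace.Completion.inner_coe,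
        UniformSpace.Completion.inner_coe, V.inner_act]
  dense_act := by
    have hd : Dense (Set.range ((↑) : V.carrier → UniformSpace.Completion V.carrier)) :=
      UniformSpace.Completion.denseRange_coe
    refine hd.mono ?_
    rintro _ ⟨x, rfl⟩
    have hx : x ∈ Submodule.span ℂ {x : V.carrier | ∃ a y, V.act a y = x} := by
      rw [V.smooth_act]; trivial
    induction hx using Submodule.span_induction with
    | mem x hx =>
      obtain ⟨a, y, rfl⟩ := hx
      exact Submodule.subset_span ⟨a, (y : UniformSpace.Completion V.carrier), V.actC_coe a y⟩
    | zero =>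
      rw [UniformSpace.Completion.coe_zero]
      exact Submodule.zero_mem _
    | add x y _ _ hx hy =>
      rw [UniformSpace.Completion.coe_add]
      exact Submodule.add_mem _ hx hy
    | smul c x _ hx =>
      rw [UniformSpace.Completion.coe_smul]
      exact Submodule.smul_mem _ c hx

namespace UnitaryRep

/-- `V` is (topologically) irreducible: it is nonzero, and `0` and `V` are its only closed
`A`-submodules. -/
def IsIrreducible (V : UnitaryRep A) : Prop :=
  Nontrivial V.carrier ∧ ∀ U : Submodule ℂ V.carrier, IsClosed (U : Set V.carrier) →
    (∀ a, ∀ x ∈ U, V.act a x ∈ U) → U = ⊥ ∨ U = ⊤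

/-- The coefficient `φ_{V,x}(a) = ⟨a x, x⟩` (Mathlib's inner product is linear in its second
variable). -/
def coeff (V : UnitaryRep A) (x : V.carrier) (a : A) : ℂ := inner ℂ x (V.act a x)

/-- `V ≺ V'`: on finite subsets of `A`, the coefficients of unit vectors of `V` are limits of
coefficients of unit vectors of `V'`. -/
def WeaklyContained (V V' : UnitaryRep A) : Prop :=
  ∀ x : V.carrier, ‖x‖ = 1 → ∀ ε : ℝ, 0 < ε → ∀ s : Finset A,
    ∃ y : V'.carrier, ‖y‖ = 1 ∧ ∀ a ∈ s, ‖V.coeff x a - V'.coeff y a‖ < ε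

/-- Unitary isomorphism of unitary representations. -/
def UnitarilyEquiv (V V' : UnitaryRep A) : Prop :=
  ∃ T : V.carrier ≃ₗᵢ[ℂ] V'.carrier, ∀ a x, T (V.act a x) = V'.act a (T x)

end UnitaryRep

variable (A)

/-- The irreducible unitary representations of `A`. -/
def IrrRep : Type (u + 1) := {V : UnitaryRep A // V.IsIrreducible}

/-- Unitary isomorphism, as an equivalence relation on the irreducible representations. -/
def irrSetoid : Setoid (IrrRep A) where
  r V V' := V.1.UnitarilyEquiv V'.1
  iseqv :=
    { refl := fun _ => ⟨LinearIsometryEquiv.refl ℂ _, fun _ _ => rfl⟩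
      symm := by
        rintro V V' ⟨T, hT⟩
        refine ⟨T.symm, fun a x => ?_⟩
        apply T.injective
        rw [hT]
        simp
      trans := by
        rintro V V' V'' ⟨T, hT⟩ ⟨T', hT'⟩
        exact ⟨T.trans T', fun a x => by simp [hT, hT']⟩ }

/-- The unitary dual of `A`: unitary isomorphism classes of irreducible unitary representations. -/
def UnitaryDual : Type (u + 1) := Quotient (irrSetoid A)

variable {A}

/-- The class `[V]` in the unitary dual. -/
def IrrRep.toDual (V : IrrRep A) : UnitaryDual A := Quotient.mk (irrSetoid A) V

/-- The set `N_{V,x,ε,s}` of the classes `[U]` such that some `y ∈ U` (not necessarily a unit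
vector) has `|φ_{V,x}(a) - φ_{U,y}(a)| < ε` for all `a ∈ s`. -/
def dualNbhd (V : IrrRep A) (x : V.1.carrier) (ε : ℝ) (s : Finset A) : Set (UnitaryDual A) :=
  {c | ∃ U : IrrRep A, U.toDual = c ∧
    ∃ y : U.1.carrier, ∀ a ∈ s, ‖V.1.coeff x a - U.1.coeff y a‖ < ε}

/-- The topology of the unitary dual: the sets `N_{V,x,ε,s}`, for `x` a unit vector and `ε > 0`,
form a subbasis. -/
instance : TopologicalSpace (UnitaryDual A) :=
  TopologicalSpace.generateFrom {N | ∃ (V : IrrRep A) (x : V.1.carrier) (ε : ℝ) (s : Finset A),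
    ‖x‖ = 1 ∧ 0 < ε ∧ N = dualNbhd V x ε s}

/-- The `A`-spectrum of a unitary representation `V'`. -/
def UnitaryRep.spec (V' : UnitaryRep A) : Set (UnitaryDual A) :=
  {c | ∃ V : IrrRep A, V.toDual = c ∧ V.1.WeaklyContained V'}

/-- The `A`-spectrum of a pre-unitary representation is that of its completion. -/
def PreUnitaryRep.spec (V' : PreUnitaryRep A) : Set (UnitaryDual A) := V'.completion.spec

end Representations

/-! ## Pre-Hilbert spaces and functors to them -/

/-- The category of complex pre-Hilbert spaces and (not necessarily continuous) linear maps. -/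
structure PHil : Type (u + 1) where
  carrier : Type u
  [normed : NormedAddCommGroup carrier]
  [innerProduct : InnerProductSpace ℂ carrier]

attribute [instance] PHil.normed PHil.innerProduct

namespace PHil

instance : CoeSort PHil.{u} (Type u) := ⟨PHil.carrier⟩

instance : Category PHil.{u} where
  Hom V W := V →ₗ[ℂ] W
  id V := LinearMap.id
  comp f g := g ∘ₗ f

/-- The linear map underlying a morphism of pre-Hilbert spaces. -/
def lin {V W : PHil.{u}} (f : V ⟶ W) : V →ₗ[ℂ] W := f

/-- The orthogonal direct sum of two pre-Hilbert spaces. -/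
def sum (V W : PHil.{u}) : PHil.{u} := ⟨WithLp 2 (V × W)⟩

/-- The objectwise orthogonal direct sum of two functors. -/
def sumFunctor {C : Type u} [Category.{v} C] (F F' : C ⥤ PHil.{u}) : C ⥤ PHil.{u} where
  obj X := sum (F.obj X) (F'.obj X)
  map f := ((lin (F.map f)).prodMap (lin (F'.map f))).withLpMap 2
  map_id X := by
    rw [F.map_id, F'.map_id]; rfl
  map_comp f g := by
    rw [F.map_comp, F'.map_comp]; rfl

/-- The inner product of finitely supported functions, `∑ₓ φ(x)‾ ψ(x)`. -/
abbrev finsuppCore (X : Type u) : InnerProductSpace.Core ℂ (X →₀ ℂ) where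
  inner φ ψ := φ.sum fun x c => star c * ψ x
  conj_inner_symm φ ψ := by
    classical
    rw [Finsupp.sum_of_support_subset φ (Finset.subset_union_left (s₂ := ψ.support)) _ (by simp),
      Finsupp.sum_of_support_subset ψ (Finset.subset_union_right (s₁ := φ.support)) _ (by simp)]
    simp [mul_comm]
  re_inner_nonneg φ := by
    simp only [Finsupp.sum, map_sum]
    refine Finset.sum_nonneg fun x _ => ?_
    simp only [RCLike.star_def, RCLike.re_to_complex, Complex.mul_re, Complex.conj_re,
      Complex.conj_im]
    nlinarith [sq_nonneg (φ x).re, sq_nonneg (φ x).im]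
  add_left φ ψ η := by
    classical
    exact Finsupp.sum_add_index' (by simp) (by intros; simp [add_mul])
  smul_left φ ψ r := by
    classical
    rw [Finsupp.sum_smul_index (by simp)]
    simp [Finsupp.sum, Finset.mul_sum, mul_assoc]
  definite φ h := by
    classical
    have h' : ∑ x ∈ φ.support, ‖φ x‖ ^ 2 = 0 := by
      have h2 : φ.sum (fun x c => star c * φ x) = ((∑ x ∈ φ.support, ‖φ x‖ ^ 2 : ℝ) : ℂ) := by
        simp [Finsupp.sum, Complex.conj_mul']
      have h3 := h2.symm.trans h
      exact_mod_cast h3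
    rw [Finset.sum_eq_zero_iff_of_nonneg (fun _ _ => by positivity)] at h'
    ext x
    by_contra hx
    exact hx (by simpa using h' x (Finsupp.mem_support_iff.mpr hx))

/-- The pre-Hilbert space of finitely supported functions on a set `X`. -/
def ell2 (X : Type u) : PHil.{u} :=
  letI := (finsuppCore X).toNormedAddCommGroup
  letI := InnerProductSpace.ofCore (finsuppCore X).toCore
  ⟨X →₀ ℂ⟩

/-- The functor `X ↦ ell2 X`; a map `f` acts by `(f_* φ)(y) = ∑_{f x = y} φ(x)`. -/
def ell2Functor : Type u ⥤ PHil.{u} where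
  obj X := ell2 X
  map f := Finsupp.lmapDomain ℂ ℂ (ConcreteCategory.hom f)
  map_id X := Finsupp.lmapDomain_id ℂ ℂ
  map_comp f g := Finsupp.lmapDomain_comp ℂ ℂ (ConcreteCategory.hom f) (ConcreteCategory.hom g)

end PHil

/-! ## Associated operators -/

section Operators

variable {C : Type u} [Category.{v} C] (F : C ⥤ PHil.{u})

/-- A family of linear operators on the spaces `F X` is a natural transformation `F → F`. -/
def IsNaturalFamily (a : ∀ X, Module.End ℂ (F.obj X)) : Prop :=
  ∀ ⦃X Y : C⦄ (f : X ⟶ Y) (x : F.obj X), PHil.lin (F.map f) (a X x) = a Y (PHil.lin (F.map f) x)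

variable {F} in
/-- The operators `b X` are dual to the operators `a X`. -/
def IsDualFamily (a b : ∀ X, Module.End ℂ (F.obj X)) : Prop :=
  ∀ X (x y : F.obj X), inner ℂ (a X x) y = inner ℂ x (b X y)

theorem IsDualFamily.symm {F : C ⥤ PHil.{u}} {a b : ∀ X, Module.End ℂ (F.obj X)}
    (h : IsDualFamily a b) : IsDualFamily b a := fun X x y => by
  rw [← inner_conj_symm, ← h X y x, inner_conj_symm]

theorem IsDualFamily.unique {F : C ⥤ PHil.{u}} {a b b' : ∀ X, Module.End ℂ (F.obj X)}
    (h : IsDualFamily a b) (h' : IsDualFamily a b') : b = b' := by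
  funext X
  refine LinearMap.ext fun y => ext_inner_left ℂ fun x => ?_
  rw [← h X x y, h' X x y]

/-- The `(C, F)`-operators: natural transformations `F → F` that admit a dual natural
transformation. The operations are objectwise. -/
def opAlgebra : Subalgebra ℂ (∀ X, Module.End ℂ (F.obj X)) where
  carrier := {a | IsNaturalFamily F a ∧ ∃ b, IsNaturalFamily F b ∧ IsDualFamily a b}
  mul_mem' := by
    rintro a a' ⟨ha, b, hb, hab⟩ ⟨ha', b', hb', hab'⟩
    exact ⟨fun X Y f x => by simp [ha f, ha' f], b' * b, fun X Y f x => by simp [hb f, hb' f],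
      fun X x y => by simp [hab X, hab' X]⟩
  add_mem' := by
    rintro a a' ⟨ha, b, hb, hab⟩ ⟨ha', b', hb', hab'⟩
    exact ⟨fun X Y f x => by simp [ha f, ha' f], b + b', fun X Y f x => by simp [hb f, hb' f],
      fun X x y => by rw [Pi.add_apply, Pi.add_apply, LinearMap.add_apply, LinearMap.add_apply,
        inner_add_left, inner_add_right, hab X, hab' X]⟩
  algebraMap_mem' c := by
    refine ⟨fun X Y f x => by simp [Module.algebraMap_end_apply],
      algebraMap ℂ _ (star c), fun X Y f x => by simp [Module.algebraMap_end_apply],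
      fun X x y => by simp [Module.algebraMap_end_apply, mul_comm]⟩

variable {F}

variable (F) in
/-- The algebra `A(C, F)` of all `(C, F)`-operators. -/
def Op : Type u := opAlgebra F

instance : Ring (Op F) := inferInstanceAs (Ring (opAlgebra F))

instance : Algebra ℂ (Op F) := inferInstanceAs (Algebra ℂ (opAlgebra F))

namespace Op

/-- The operator `a_X` on `F X`. -/
def app (a : Op F) (X : C) : Module.End ℂ (F.obj X) := a.1 X

/-- The involution of the algebra of operators takes an operator to its dual. -/
instance : Star (Op F) where
  star a := ⟨a.2.2.choose, a.2.2.choose_spec.1, a.1, a.2.1, a.2.2.choose_spec.2.symm⟩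

theorem inner_app (a : Op F) (X : C) (x y : F.obj X) :
    inner ℂ (a.app X x) y = inner ℂ x ((star a).app X y) :=
  a.2.2.choose_spec.2 X x y

theorem star_eq_of_dual {a b : Op F}
    (h : ∀ X (x y : F.obj X), inner ℂ (a.app X x) y = inner ℂ x (b.app X y)) : star a = b :=
  Subtype.ext (IsDualFamily.unique (a := a.1) a.2.2.choose_spec.2 h)

theorem add_app (a b : Op F) (X : C) (x : F.obj X) :
    (a + b).app X x = a.app X x + b.app X x := rfl

theorem mul_app (a b : Op F) (X : C) (x : F.obj X) :
    (a * b).app X x = a.app X (b.app X x) := rfl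

theorem smul_app (c : ℂ) (a : Op F) (X : C) (x : F.obj X) :
    (c • a).app X x = c • a.app X x := rfl

instance : StarRing (Op F) where
  star_involutive a := star_eq_of_dual fun X x y => by
    rw [← inner_conj_symm, ← inner_app, inner_conj_symm]
  star_mul a b := star_eq_of_dual fun X x y => by
    rw [mul_app, mul_app, inner_app, inner_app]
  star_add a b := star_eq_of_dual fun X x y => by
    rw [add_app, add_app, inner_add_left, inner_add_right, inner_app, inner_app]

instance : StarModule ℂ (Op F) where
  star_smul c a := star_eq_of_dual fun X x y => by
    rw [smul_app, smul_app, inner_smul_left, inner_smul_right, inner_app]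
    rfl

end Op

variable (A : NonUnitalStarSubalgebra ℂ (Op F))

/-- `A` acts continuously on `F X`. -/
def ActsContinuously (X : C) : Prop :=
  ∀ a ∈ A, ∃ M : ℝ, ∀ x : F.obj X, ‖a.app X x‖ ≤ M * ‖x‖

/-- The subspace `A · F X` of `F X`. -/
def smoothPart (X : C) : Submodule ℂ (F.obj X) :=
  Submodule.span ℂ {x | ∃ a ∈ A, ∃ y, a.app X y = x}

variable {A} in
theorem apply_mem_smoothPart {a : Op F} (ha : a ∈ A) (X : C) (x : F.obj X) :
    a.app X x ∈ smoothPart A X :=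
  Submodule.subset_span ⟨a, ha, x, rfl⟩

/-- The pre-unitary representation of an algebra `A` of `(C, F)`-operators on `A · F X`, when `A`
acts continuously on `F X`. -/
def smoothRep (hA : IsIdempotented A) (X : C) (hX : ActsContinuously A X) : PreUnitaryRep A where
  carrier := smoothPart A X
  act :=
    { toFun := fun a => (a.1.app X).restrict fun x _ => apply_mem_smoothPart a.2 X x
      map_smul' := fun _ _ => rfl
      map_zero' := rfl
      map_add' := fun _ _ => rfl
      map_mul' := fun _ _ => rfl }
  bounded_act a := (hX a.1 a.2).imp fun _ hM x => hM x.1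
  inner_act a x y := a.1.inner_app X x.1 y.1
  smooth_act := by
    rw [eq_top_iff]
    rintro ⟨x, hx⟩ -
    induction hx using Submodule.span_induction with
    | mem x hx =>
      obtain ⟨a, ha, y, rfl⟩ := hx
      obtain ⟨e, -, he⟩ := hA {⟨a, ha⟩}
      have he' := he ⟨a, ha⟩ (Finset.mem_singleton_self _)
      refine Submodule.subset_span
        ⟨e, ⟨a.app X (e.1.app X y), apply_mem_smoothPart ha X _⟩, Subtype.ext ?_⟩
      have h := congrArg (fun b : A => b.1.app X y) he'
      exact h
    | zero => exact Submodule.zero_mem _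
    | add x y hx hy ihx ihy => exact Submodule.add_mem _ ihx ihy
    | smul c x hx ih => exact Submodule.smul_mem _ c ih

/-- The `A`-spectrum of `X`, for an algebra `A` of `(C, F)`-operators acting continuously on
`F X`. -/
def opSpec (hA : IsIdempotented A) (X : C) (hX : ActsContinuously A X) : Set (UnitaryDual A) :=
  (smoothRep A hA X hX).spec

end Operators

/-! ## Simplicial complexes and their quotients -/

section Complexes

variable {V : Type v}

/-- The cells `x` and `y` have combinatorial distance at most `n`: they are equal, or they are
joined by a sequence of at most `n` cells, successive ones intersecting, the first of which
contains `x` and the last of which contains `y`. -/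
def CellDistLE (K : AbstractSimplicialComplex V) (x y : Finset V) (n : ℕ) : Prop :=
  x = y ∨ ∃ (t : ℕ) (c : ℕ → Finset V), t + 1 ≤ n ∧ (∀ i ≤ t, c i ∈ K) ∧ x ⊆ c 0 ∧ y ⊆ c t ∧
    ∀ i < t, ∃ p, p ∈ c i ∧ p ∈ c (i + 1)

/-- The combinatorial ball of radius `n` around the vertex `p`. -/
def vertexBall (K : AbstractSimplicialComplex V) (p : V) (n : ℕ) : Set K :=
  {x | CellDistLE K {p} x.1 n}

/-- `K` is connected: it has a cell, and the distance between any two cells is finite. -/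
def IsConnectedComplex (K : AbstractSimplicialComplex V) : Prop :=
  Nonempty V ∧ ∀ x ∈ K, ∀ y ∈ K, ∃ n, CellDistLE K x y n

/-- Every cell is contained in finitely many cells. -/
def IsLocallyFiniteComplex (K : AbstractSimplicialComplex V) : Prop :=
  ∀ x ∈ K, {y | y ∈ K ∧ x ⊆ y}.Finite

open Classical in
/-- A cover map `K → L`: a map on vertices that takes `i`-cells to `i`-cells, is surjective, and
maps the cells containing a vertex `p` bijectively to the cells containing `f p`. -/
structure IsCoverMap {W : Type w} (K : AbstractSimplicialComplex V)
    (L : AbstractSimplicialComplex W) (f : V → W) : Prop where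
  image_mem : ∀ x ∈ K, x.image f ∈ L
  injOn : ∀ x ∈ K, Set.InjOn f x
  surjective : Function.Surjective f
  bijOn_star : ∀ p : V,
    Set.BijOn (Finset.image f) {x | x ∈ K ∧ p ∈ x} {y | y ∈ L ∧ f p ∈ y}

variable {G : Type u} [Group G] [MulAction G V]

/-- The translate `g x = {g p | p ∈ x}` of a cell. -/
def cellSMul (g : G) (x : Finset V) : Finset V := x.map (MulAction.toPerm g).toEmbedding

theorem mem_cellSMul {g : G} {x : Finset V} {p : V} : p ∈ cellSMul g x ↔ g⁻¹ • p ∈ x := by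
  simp [cellSMul, MulAction.toPerm]

theorem cellSMul_one (x : Finset V) : cellSMul (1 : G) x = x := by
  ext p; simp [mem_cellSMul]

theorem cellSMul_mul (g h : G) (x : Finset V) : cellSMul (g * h) x = cellSMul g (cellSMul h x) := by
  ext p; simp [mem_cellSMul, mul_smul]

/-- The equivalence relation on the cells of `K` whose quotient is `Γ \ K`. -/
def cellOrbitRel (K : AbstractSimplicialComplex V) (Γ : Subgroup G) : Setoid K where
  r x y := ∃ γ ∈ Γ, cellSMul γ x.1 = y.1
  iseqv :=
    { refl := fun x => ⟨1, Γ.one_mem, cellSMul_one _⟩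
      symm := by
        rintro x y ⟨γ, hγ, h⟩
        exact ⟨γ⁻¹, Γ.inv_mem hγ, by rw [← h, ← cellSMul_mul, inv_mul_cancel, cellSMul_one]⟩
      trans := by
        rintro x y z ⟨γ, hγ, h⟩ ⟨δ, hδ, h'⟩
        exact ⟨δ * γ, Γ.mul_mem hδ hγ, by rw [cellSMul_mul, h, h']⟩ }

variable (G) in
/-- `K` is a `G`-complex: a connected, locally finite simplicial complex on which `G` acts
faithfully by automorphisms, such that stabilizers of cells are compact and open in `G`. -/
structure IsGComplex [TopologicalSpace G] (K : AbstractSimplicialComplex V) : Prop where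
  connected : IsConnectedComplex K
  locallyFinite : IsLocallyFiniteComplex K
  faithful : FaithfulSMul G V
  smul_mem : ∀ (g : G), ∀ x ∈ K, cellSMul g x ∈ K
  isCompact_stabilizer : ∀ x ∈ K, IsCompact {g : G | cellSMul g x = x}
  isOpen_stabilizer : ∀ x ∈ K, IsOpen {g : G | cellSMul g x = x}

variable (G) in
/-- `G \ K` is finite. -/
def IsAlmostTransitive (K : AbstractSimplicialComplex V) : Prop :=
  Finite (Quotient (cellOrbitRel K (⊤ : Subgroup G)))

open Classical in
/-- `Γ ≤_K G`: the partially ordered set `Γ \ K` (where `Γ x ≤ Γ y` if `γ x ⊆ y` for some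
`γ ∈ Γ`) is a simplicial complex, and the projection `K → Γ \ K` is a cover map. That is, there
are a simplicial complex `L` and a cover map `f : K → L` that induces an isomorphism of partially
ordered sets between `Γ \ K` and `L`. -/
def IsCoverSubgroup (K : AbstractSimplicialComplex V) (Γ : Subgroup G) : Prop :=
  ∃ (W : Type v) (L : AbstractSimplicialComplex W) (f : V → W), IsCoverMap K L f ∧
    ∀ x ∈ K, ∀ y ∈ K, x.image f ⊆ y.image f ↔ ∃ γ ∈ Γ, cellSMul γ x ⊆ y

theorem isCoverSubgroup_bot (K : AbstractSimplicialComplex V) :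
    IsCoverSubgroup K (⊥ : Subgroup G) := by
  classical
  refine ⟨V, K, id, ⟨fun x hx => by simpa using hx, fun x _ => Set.injOn_id _,
    Function.surjective_id, fun p => ?_⟩, fun x _ y _ => ?_⟩
  · have h : Finset.image (id : V → V) = id := funext fun x => Finset.image_id
    rw [h]
    exact Set.bijOn_id _
  · simp [Subgroup.mem_bot, cellSMul_one]

end Complexes

/-! ## The category of quotients of a `G`-complex -/

section QuotientCategory

variable {V : Type v} {G : Type u} [Group G] [MulAction G V]

variable (G) in
/-- The objects `Γ \ K`, for `Γ ≤_K G`, of the category of `G`-quotients of `K`. -/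
structure GQuotient (K : AbstractSimplicialComplex V) : Type u where
  Γ : Subgroup G
  isCover : IsCoverSubgroup K Γ

namespace GQuotient

variable {K : AbstractSimplicialComplex V}

/-- The vertex set of `Γ \ K`. -/
def Vert (X : GQuotient G K) : Type v := MulAction.orbitRel.Quotient X.Γ V

/-- The vertex `Γ p` of `Γ \ K`. -/
def proj (X : GQuotient G K) (p : V) : X.Vert :=
  Quotient.mk (MulAction.orbitRel X.Γ V) p

theorem proj_eq_iff {X : GQuotient G K} {p q : V} :
    X.proj p = X.proj q ↔ ∃ γ ∈ X.Γ, γ • q = p := by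
  refine Iff.trans (Quotient.eq (r := MulAction.orbitRel X.Γ V)) ?_
  exact ⟨fun ⟨γ, h⟩ => ⟨γ.1, γ.2, h⟩, fun ⟨γ, hγ, h⟩ => ⟨⟨γ, hγ⟩, h⟩⟩

theorem proj_surjective (X : GQuotient G K) : Function.Surjective X.proj := Quotient.mk_surjective

/-- The maps of complexes that are morphisms `Γ' \ K → Γ \ K`: if `Γ' = 1`, the maps `p_Γ ∘ g`
with `g ∈ G`; if `1 ≠ Γ' ≤ Γ`, only the projection `p_{Γ',Γ}`; otherwise there are none. -/
def IsMor (X Y : GQuotient G K) (f : X.Vert → Y.Vert) : Prop :=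
  (X.Γ = ⊥ ∧ ∃ g : G, ∀ p : V, f (X.proj p) = Y.proj (g • p)) ∨
    (X.Γ ≠ ⊥ ∧ X.Γ ≤ Y.Γ ∧ ∀ p : V, f (X.proj p) = Y.proj p)

instance : Category.{v} (GQuotient G K) where
  Hom X Y := {f : X.Vert → Y.Vert // IsMor X Y f}
  id X := ⟨id, by
    by_cases h : X.Γ = ⊥
    · exact Or.inl ⟨h, 1, fun p => by simp⟩
    · exact Or.inr ⟨h, le_rfl, fun p => rfl⟩⟩
  comp {X Y Z} f g := ⟨g.1 ∘ f.1, by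
    obtain ⟨f, hf⟩ := f
    obtain ⟨g, hg⟩ := g
    rcases hf with ⟨hX, a, hf⟩ | ⟨hX, hXY, hf⟩
    · rcases hg with ⟨hY, b, hg⟩ | ⟨hY, hYZ, hg⟩
      · exact Or.inl ⟨hX, b * a, fun p => by simp [hf, hg, mul_smul]⟩
      · exact Or.inl ⟨hX, a, fun p => by simp [hf, hg]⟩
    · rcases hg with ⟨hY, b, hg⟩ | ⟨hY, hYZ, hg⟩
      · exact absurd (le_bot_iff.mp (hY ▸ hXY)) hX
      · exact Or.inr ⟨hX, hXY.trans hYZ, fun p => by simp [hf, hg]⟩⟩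

variable (G K) in
/-- The complex `K` itself, as the quotient `1 \ K`. -/
def base : GQuotient G K := ⟨⊥, isCoverSubgroup_bot K⟩

/-- The morphism `p_Γ ∘ g : K → Γ \ K`. -/
def projHom (X : GQuotient G K) (g : G) : base G K ⟶ X :=
  ⟨Quotient.lift (fun p => X.proj (g • p)) (by
    rintro p q ⟨⟨γ, hγ⟩, h⟩
    obtain rfl : γ = 1 := hγ
    have h' : q = p := by rw [← h]; exact (one_smul G q).symm
    rw [h']), Or.inl ⟨rfl, g, fun _ => rfl⟩⟩

theorem projHom_proj (X : GQuotient G K) (g : G) (p : V) :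
    (X.projHom g).1 ((base G K).proj p) = X.proj (g • p) := rfl

theorem hom_ext {X Y : GQuotient G K} {f f' : X ⟶ Y} (h : ∀ p, f.1 (X.proj p) = f'.1 (X.proj p)) :
    f = f' :=
  Subtype.ext (funext fun x => by obtain ⟨p, rfl⟩ := X.proj_surjective x; exact h p)

theorem projHom_comp (X : GQuotient G K) (g h : G) :
    (base G K).projHom h ≫ X.projHom g = X.projHom (g * h) :=
  hom_ext fun p => by
    change (X.projHom g).1 (((base G K).projHom h).1 ((base G K).proj p)) = _
    rw [projHom_proj, projHom_proj, projHom_proj, mul_smul]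

theorem projHom_one : (base G K).projHom (1 : G) = 𝟙 (base G K) :=
  hom_ext fun p => by rw [projHom_proj, one_smul]; rfl

theorem projHom_of_mem (X : GQuotient G K) {γ : G} (hγ : γ ∈ X.Γ) :
    X.projHom γ = X.projHom 1 :=
  hom_ext fun p => by
    rw [projHom_proj, projHom_proj, proj_eq_iff]
    exact ⟨γ, hγ, by rw [one_smul]⟩

/-- The set `S K`, for a functor `S` from the category of quotients of `K` to sets. -/
def BaseSet (S : GQuotient G K ⥤ Type u) : Type u := S.obj (base G K)

/-- `G` acts on `S K` through the endomorphisms `g : K → K`. -/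
instance (S : GQuotient G K ⥤ Type u) : MulAction G (BaseSet S) where
  smul g x := S.map ((base G K).projHom g) x
  one_smul x := by
    change S.map ((base G K).projHom 1) x = x
    rw [projHom_one, S.map_id]; rfl
  mul_smul g h x := by
    change S.map ((base G K).projHom (g * h)) x =
      S.map ((base G K).projHom g) (S.map ((base G K).projHom h) x)
    rw [← projHom_comp, S.map_comp]; rfl

theorem base_smul_def (S : GQuotient G K ⥤ Type u) (g : G) (x : BaseSet S) :
    g • x = S.map ((base G K).projHom g) x := rfl

/-- The map `Γ \ S K → S (Γ \ K)`, `Γ x ↦ (S p_Γ) x`. -/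
def orbitMap (S : GQuotient G K ⥤ Type u) (X : GQuotient G K) :
    MulAction.orbitRel.Quotient X.Γ (BaseSet S) → S.obj X :=
  Quotient.lift (fun x : BaseSet S => S.map (X.projHom 1) x) (by
    rintro x y ⟨⟨γ, hγ⟩, h⟩
    have h' : γ • y = x := h
    change S.map (X.projHom 1) x = S.map (X.projHom 1) y
    have h2 : S.map (X.projHom 1) (S.map ((base G K).projHom γ) y) = S.map (X.projHom γ) y := by
      have h3 := X.projHom_comp 1 γ
      rw [one_mul] at h3
      rw [← h3, S.map_comp]
      rfl
    rw [← h', base_smul_def, h2, X.projHom_of_mem hγ])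

variable [TopologicalSpace G]

/-- `F` is elementary: it is unitarily isomorphic to `ell2 ∘ S` for a set-valued functor `S` such
that stabilizers of points of `S K` are compact, open and contained in stabilizers of cells of
`K`, the maps `Γ \ S K → S (Γ \ K)` are bijective, and `G \ S K` is finite. -/
def IsElementary (F : GQuotient G K ⥤ PHil.{u}) : Prop :=
  ∃ S : GQuotient G K ⥤ Type u,
    (∃ i : S ⋙ PHil.ell2Functor ≅ F,
      ∀ (X : GQuotient G K) (φ ψ : (S ⋙ PHil.ell2Functor).obj X),
        inner ℂ (PHil.lin (i.hom.app X) φ) (PHil.lin (i.hom.app X) ψ) = inner ℂ φ ψ) ∧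
    (∀ x : BaseSet S,
      IsCompact (MulAction.stabilizer G x : Set G) ∧ IsOpen (MulAction.stabilizer G x : Set G) ∧
        ∃ c ∈ K, ∀ g ∈ MulAction.stabilizer G x, cellSMul g c = c) ∧
    (∀ X : GQuotient G K, Function.Bijective (orbitMap S X)) ∧
    Finite (MulAction.orbitRel.Quotient G (BaseSet S))

/-- `F` is semi-elementary: `F ⊕ F'` is elementary for some functor `F'`. -/
def IsSemiElementary (F : GQuotient G K ⥤ PHil.{u}) : Prop :=
  ∃ F' : GQuotient G K ⥤ PHil.{u}, IsElementary (PHil.sumFunctor F F')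

end GQuotient

/-- Every compact set containing `1` meets some conjugate `g⁻¹ Γ_α g` only in `1`. -/
def AvoidsCompactSets [TopologicalSpace G] {ι : Type w} (Γ : ι → Subgroup G) : Prop :=
  ∀ C : Set G, IsCompact C → 1 ∈ C →
    ∃ (α : ι) (g : G), C ∩ (fun γ => g⁻¹ * γ * g) '' (Γ α : Set G) = {1}

/-- For every `n`, some quotient map `K → Γ_α \ K` is injective on some ball of radius `n` around
a vertex. -/
def InjectsOnBalls (K : AbstractSimplicialComplex V) {ι : Type w} (Γ : ι → Subgroup G) : Prop :=
  ∀ n : ℕ, ∃ (α : ι) (p : V), Set.InjOn (Quotient.mk (cellOrbitRel K (Γ α))) (vertexBall K p n)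

end QuotientCategory

end

/-!
# Spectra of quotients of a complex with growing injectivity radius

The equivalence of the two conditions on the groups `Γ α` is the dictionary between compact subsets
of `G` and balls of the complex. The translations that map some cell of a fixed ball to another one
form a compact set (`AvoidsCompactSets.injectsOnBalls`). Conversely a compact set moves
representatives of the finitely many orbits of vertices by a bounded distance, and an element of a
cover subgroup that fixes a vertex is trivial (`InjectsOnBalls.avoidsCompactSets`).

A semi-elementary functor is a direct summand of `ℓ² ∘ S`, and the columns of the matrix of an
operator over any quotient are images of finitely many columns over the complex itself. The Schur
test thus bounds the operator, uniformly over all quotients (`EllTwoSummand.exists_bound`).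

For the spectra, let `V` be irreducible and weakly contained in the representation on `F K`. A
vector of `F K` and its images under finitely many operators are supported on finitely many points
of `S K`, whose stabilizers are compact. By the first condition some morphism `K → Γ α \ K` is
injective on these points, and hence preserves the corresponding coefficients
(`EllTwoSummand.exists_inner_map_eq`). So the coefficients of `V` are limits of coefficients of the
representations `V' α` on the spaces `F (Γ α \ K)`.

It remains to replace the vectors of the `V' α`, which are not irreducible, by vectors of
irreducible representations that are weakly contained in the `V' α`. This is Fell's theorem
`IrrRep.toDual_mem_closure_iUnion_spec`, and it rests on convexity. Fix a projection `e ∈ A`. The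
states of the corner `e A e` that satisfy the uniform bounds form a compact convex set, in which the
coefficient `φ` of an `e`-fixed unit vector of `V` is an extreme point by Schur's lemma
(`IsIrreducible.coeff_mem_extremePoints`). Let `Q α` be the closed convex hull of the coefficients
of the `e`-fixed unit vectors of `V' α`. By the Krein–Milman theorem and Milman's converse
(`mem_closure_of_mem_extremePoints`) `φ` is a limit of extreme points of the sets `Q α`. The
Gelfand–Naimark–Segal representation of an extreme point of `Q α` is irreducible
(`IsState.isIrreducible_gns`), and it is weakly contained in `V' α` since the extreme point is a
limit of coefficients of `V' α`, again by Milman's converse. Finally, the topology of the dual near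
`[V]` is controlled by the coefficient of one cyclic vector (`IrrRep.exists_mem_nhds_coeff`).
-/

noncomputable section

/-! ### Extreme points of compact convex sets -/

section Milman

variable {E : Type*} [AddCommGroup E] [Module ℝ E] [TopologicalSpace E] [IsTopologicalAddGroup E]
  [ContinuousSMul ℝ E]

theorem IsCompact.convexJoin {s t : Set E} (hs : IsCompact s) (ht : IsCompact t) :
    IsCompact (convexJoin ℝ s t) := by
  have h : _root_.convexJoin ℝ s t =
      (fun q : ℝ × E × E => (1 - q.1) • q.2.1 + q.1 • q.2.2) '' (Set.Icc 0 1 ×ˢ s ×ˢ t) := by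
    ext x
    simp only [mem_convexJoin, segment_eq_image, Set.mem_image, Set.mem_prod, Prod.exists]
    constructor
    · rintro ⟨a, ha, b, hb, θ, hθ, rfl⟩
      exact ⟨θ, a, b, ⟨hθ, ha, hb⟩, rfl⟩
    · rintro ⟨θ, a, b, ⟨hθ, ha, hb⟩, rfl⟩
      exact ⟨a, ha, b, hb, θ, hθ, rfl⟩
  rw [h]
  exact (isCompact_Icc.prod (hs.prod ht)).image (by fun_prop)

theorem isCompact_convexHull_biUnion {ι : Type*} (K : ι → Set E) (t : Finset ι)
    (hK : ∀ i ∈ t, IsCompact (K i)) (hK' : ∀ i ∈ t, Convex ℝ (K i)) :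
    IsCompact (convexHull ℝ (⋃ i ∈ t, K i)) := by
  classical
  induction t using Finset.induction_on with
  | empty => simp
  | insert i t hi ih =>
    rw [Finset.set_biUnion_insert]
    have h1 := ih (fun j hj => hK j (Finset.mem_insert_of_mem hj))
      (fun j hj => hK' j (Finset.mem_insert_of_mem hj))
    have h2 := hK i (Finset.mem_insert_self _ _)
    rcases (K i).eq_empty_or_nonempty with h | h
    · rwa [h, Set.empty_union]
    rcases (⋃ j ∈ t, K j).eq_empty_or_nonempty with h' | h'
    · rw [h', Set.union_empty, (hK' i (Finset.mem_insert_self _ _)).convexHull_eq]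
      exact h2
    rw [convexHull_union h h', (hK' i (Finset.mem_insert_self _ _)).convexHull_eq]
    exact h2.convexJoin h1

/-- **Milman's converse** of the Krein–Milman theorem: if `T` generates a closed convex subset of
the compact convex set `S`, an extreme point of `S` lying in it is in the closure of `T`. -/
theorem mem_closure_of_mem_extremePoints [LocallyConvexSpace ℝ E] [T2Space E] {S T : Set E}
    (hS : IsCompact S) (hS' : Convex ℝ S) (hTS : T ⊆ S) {x : E} (hx : x ∈ S.extremePoints ℝ)
    (hxT : x ∈ closure (convexHull ℝ T)) : x ∈ closure T := by
  by_contra hcl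
  have hclS : closure T ⊆ S := closure_minimal hTS hS.isClosed
  -- Every point of `closure T` has a closed convex neighbourhood that misses `x`.
  have hnb : ∀ y ∈ closure T, ∃ C ∈ nhds y, IsClosed C ∧ Convex ℝ C ∧ x ∉ C := by
    intro y hy
    have hyx : ({x}ᶜ : Set E) ∈ nhds y :=
      isOpen_compl_singleton.mem_nhds fun h : y = x => hcl (h ▸ hy)
    obtain ⟨D, ⟨hD, hDc⟩, hDx⟩ := (closed_nhds_basis y).mem_iff.1 hyx
    obtain ⟨C, ⟨hC, hCc⟩, hCD⟩ := (LocallyConvexSpace.convex_basis (𝕜 := ℝ) y).mem_iff.1 hD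
    exact ⟨closure C, Filter.mem_of_superset hC subset_closure, isClosed_closure, hCc.closure,
      fun h => hDx (closure_minimal hCD hDc h) rfl⟩
  choose! C hC hCc hCv hCx using hnb
  obtain ⟨t, htT, ht⟩ := (hS.of_isClosed_subset isClosed_closure hclS).elim_nhds_subcover C hC
  have hK := isCompact_convexHull_biUnion (fun y => C y ∩ S) t
    (fun y hy => (hS.inter_left (hCc y (htT y hy)))) (fun y hy => (hCv y (htT y hy)).inter hS')
  have hTK : T ⊆ ⋃ y ∈ t, C y ∩ S := fun z hz => by
    obtain ⟨y, hy, hzy⟩ := Set.mem_iUnion₂.1 (ht (subset_closure hz))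
    exact Set.mem_iUnion₂.2 ⟨y, hy, hzy, hTS hz⟩
  have hxK := closure_minimal (convexHull_mono hTK) hK.isClosed hxT
  have hKS : convexHull ℝ (⋃ y ∈ t, C y ∩ S) ⊆ S :=
    convexHull_min (Set.iUnion₂_subset fun y _ => Set.inter_subset_right) hS'
  have hx' := extremePoints_convexHull_subset
    (inter_extremePoints_subset_extremePoints_of_subset hKS ⟨hxK, hx⟩)
  obtain ⟨y, hy, hxy, -⟩ := Set.mem_iUnion₂.1 hx'
  exact hCx y (htT y hy) hxy

end Milman

/-! ### Coefficients of unitary representations -/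

section ConjCoeff

variable {A : Type u} [NonUnitalRing A] [StarRing A]

theorem IsStarProjection.mul_eq_of_mul_mul_eq {e a : A} (he : IsStarProjection e)
    (h : e * a * e = a) : e * a = a := by
  nth_rewrite 1 [← h]
  rw [mul_assoc, ← mul_assoc, he.isIdempotentElem.eq, ← mul_assoc, h]

/-- The functional `c ↦ χ(a* c a) / χ(a* a)`: the coefficient of the unit vector `a x / ‖a x‖` when
`χ` is the coefficient of `x`. If `χ(a* a) = 0`, its value is the junk value `0`. -/
def conjCoeff (a : A) (χ : A → ℂ) : A → ℂ := fun c => χ (star a * c * a) / χ (star a * a)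

theorem continuousAt_conjCoeff {a : A} {χ : A → ℂ} (h : χ (star a * a) ≠ 0) :
    ContinuousAt (conjCoeff a) χ :=
  continuousAt_pi.2 fun _ => (continuous_apply _).continuousAt.div
    (continuous_apply _).continuousAt h

theorem conjCoeff_mem_closure {a : A} {χ : A → ℂ} (h : χ (star a * a) ≠ 0) {T T' : Set (A → ℂ)}
    (hχ : χ ∈ closure T) (hT : ∀ η ∈ T, η (star a * a) ≠ 0 → conjCoeff a η ∈ T') :
    conjCoeff a χ ∈ closure T' := by
  have ho : IsOpen {η : A → ℂ | η (star a * a) ≠ 0} :=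
    isOpen_ne_fun (continuous_apply _) continuous_const
  have hχ' : χ ∈ closure ({η : A → ℂ | η (star a * a) ≠ 0} ∩ T) :=
    ho.inter_closure ⟨h, hχ⟩
  exact (continuousAt_conjCoeff h).continuousWithinAt.mem_closure hχ' fun η hη => hT η hη.2 hη.1

end ConjCoeff

section Coefficients

variable {A : Type u} [NonUnitalRing A] [Module ℂ A] [StarRing A]

namespace UnitaryRep

variable (V : UnitaryRep A)

theorem act_mul_apply (a b : A) (x : V.carrier) : V.act (a * b) x = V.act a (V.act b x) := by
  rw [map_mul]; rfl

theorem coeff_act (b : A) (x : V.carrier) (a : A) :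
    V.coeff (V.act b x) a = V.coeff x (star b * a * b) := by
  rw [coeff, coeff, V.inner_act, mul_assoc, V.act_mul_apply, V.act_mul_apply]

theorem coeff_smul (c : ℂ) (x : V.carrier) (a : A) :
    V.coeff (c • x) a = star c * c * V.coeff x a := by
  rw [coeff, coeff, map_smul, inner_smul_left, inner_smul_right, RCLike.star_def, mul_assoc]

theorem continuous_coeff : Continuous V.coeff :=
  continuous_pi fun a => continuous_id.inner (V.act a).continuous

theorem inner_act_act (a b : A) (x y : V.carrier) :
    inner ℂ (V.act a x) (V.act b y) = inner ℂ x (V.act (star a * b) y) := by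
  rw [V.inner_act, V.act_mul_apply]

theorem coeff_star_mul_self (a : A) (x : V.carrier) :
    V.coeff x (star a * a) = (‖V.act a x‖ : ℂ) ^ 2 := by
  rw [coeff, ← V.inner_act_act, inner_self_eq_norm_sq_to_K]
  rfl

/-- In a representation of an idempotented algebra the vectors `a v` form a subspace, so that they
are dense. -/
theorem dense_range_act (hA : IsIdempotented A) : Dense {x : V.carrier | ∃ a y, V.act a y = x} := by
  refine V.dense_act.mono fun x hx => ?_
  suffices h : ∃ e : A, V.act e x = x from h.imp fun e he => ⟨x, he⟩
  suffices h : ∃ t : Finset A, ∀ e : A, (∀ a ∈ t, e * a * e = a) → IsStarProjection e →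
      V.act e x = x by
    obtain ⟨t, ht⟩ := h
    obtain ⟨e, he, het⟩ := hA t
    exact ⟨e, ht e het he⟩
  classical
  induction hx using Submodule.span_induction with
  | mem x hx =>
    obtain ⟨a, y, rfl⟩ := hx
    refine ⟨{a}, fun e he he' => ?_⟩
    rw [← V.act_mul_apply]
    rw [he'.mul_eq_of_mul_mul_eq (he a (Finset.mem_singleton_self a))]
  | zero => exact ⟨∅, fun e _ _ => map_zero _⟩
  | add x y _ _ hx hy =>
    obtain ⟨s, hs⟩ := hx
    obtain ⟨t, ht⟩ := hy
    refine ⟨s ∪ t, fun e he he' => ?_⟩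
    rw [map_add, hs e (fun a ha => he a (Finset.mem_union_left _ ha)) he',
      ht e (fun a ha => he a (Finset.mem_union_right _ ha)) he']
  | smul c x _ hx =>
    obtain ⟨t, ht⟩ := hx
    exact ⟨t, fun e he he' => by rw [map_smul, ht e he he']⟩

/-- The coefficients of the unit vectors of a unitary representation. -/
def unitCoeffs : Set (A → ℂ) := {χ | ∃ x : V.carrier, ‖x‖ = 1 ∧ V.coeff x = χ}

/-- The coefficients of the unit vectors that are fixed by `e`. -/
def fixedCoeffs (e : A) : Set (A → ℂ) :=
  {χ | ∃ x : V.carrier, ‖x‖ = 1 ∧ V.act e x = x ∧ V.coeff x = χ}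

theorem weaklyContained_iff {V V' : UnitaryRep A} :
    V.WeaklyContained V' ↔ ∀ x : V.carrier, ‖x‖ = 1 → V.coeff x ∈ closure V'.unitCoeffs := by
  classical
  refine forall₂_congr fun x _ => ?_
  rw [mem_closure_iff_nhds]
  constructor
  · intro h t ht
    rw [nhds_pi, Filter.mem_pi] at ht
    obtain ⟨I, hI, s, hs, hst⟩ := ht
    choose ε hε hεs using fun a => Metric.mem_nhds_iff.1 (hs a)
    obtain ⟨δ, hδ, hδε⟩ : ∃ δ > 0, ∀ a ∈ I, δ ≤ ε a := by
      rcases hI.toFinset.eq_empty_or_nonempty with h0 | h0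
      · exact ⟨1, one_pos, fun a ha => absurd (hI.mem_toFinset.2 ha) (by simp [h0])⟩
      · exact ⟨hI.toFinset.inf' h0 ε, (Finset.lt_inf'_iff h0).2 fun a _ => hε a,
          fun a ha => Finset.inf'_le _ (hI.mem_toFinset.2 ha)⟩
    obtain ⟨y, hy, hyx⟩ := h δ hδ hI.toFinset
    refine ⟨V'.coeff y, hst fun a ha => hεs a ?_, y, hy, rfl⟩
    rw [Metric.mem_ball, dist_comm, dist_eq_norm]
    exact (hyx a (hI.mem_toFinset.2 ha)).trans_le (hδε a ha)
  · intro h ε hε s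
    obtain ⟨_, hχ, y, hy, rfl⟩ := h (Set.pi s fun a => Metric.ball (V.coeff x a) ε)
      (set_pi_mem_nhds s.finite_toSet fun a _ => Metric.ball_mem_nhds _ hε)
    refine ⟨y, hy, fun a ha => ?_⟩
    have := hχ a ha
    rwa [Metric.mem_ball, dist_comm, dist_eq_norm] at this

theorem coeff_normalize (x : V.carrier) (c : A) :
    V.coeff (((‖x‖⁻¹ : ℝ) : ℂ) • x) c = V.coeff x c / (‖x‖ : ℂ) ^ 2 := by
  rw [coeff_smul]
  rw [RCLike.star_def, Complex.conj_ofReal, Complex.ofReal_inv]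
  rw [div_eq_mul_inv, mul_comm]
  congr 1
  rw [sq, mul_inv]

theorem norm_normalize {x : V.carrier} (hx : x ≠ 0) : ‖((‖x‖⁻¹ : ℝ) : ℂ) • x‖ = 1 := by
  rw [norm_smul, Complex.norm_real, norm_inv, norm_norm, inv_mul_cancel₀ (norm_ne_zero_iff.2 hx)]

theorem conjCoeff_coeff (a : A) (x : V.carrier) :
    conjCoeff a (V.coeff x) = V.coeff (((‖V.act a x‖⁻¹ : ℝ) : ℂ) • V.act a x) := by
  funext c
  rw [coeff_normalize, conjCoeff, coeff_star_mul_self, coeff_act]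

theorem act_ne_zero_of_coeff_ne_zero {a : A} {x : V.carrier} (h : V.coeff x (star a * a) ≠ 0) :
    V.act a x ≠ 0 := by
  rw [coeff_star_mul_self] at h
  exact fun h' => h (by simp [h'])

theorem coeff_ne_zero_of_act_ne_zero {a : A} {x : V.carrier} (h : V.act a x ≠ 0) :
    V.coeff x (star a * a) ≠ 0 := by
  rw [coeff_star_mul_self]
  exact pow_ne_zero 2 (Complex.ofReal_ne_zero.2 (norm_ne_zero_iff.2 h))

theorem conjCoeff_mem_unitCoeffs {a : A} {x : V.carrier} (h : V.coeff x (star a * a) ≠ 0) :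
    conjCoeff a (V.coeff x) ∈ V.unitCoeffs :=
  ⟨_, V.norm_normalize (V.act_ne_zero_of_coeff_ne_zero h), (V.conjCoeff_coeff a x).symm⟩

theorem conjCoeff_mem_fixedCoeffs {e a : A} (hea : e * a = a) {x : V.carrier}
    (h : V.coeff x (star a * a) ≠ 0) : conjCoeff a (V.coeff x) ∈ V.fixedCoeffs e :=
  ⟨_, V.norm_normalize (V.act_ne_zero_of_coeff_ne_zero h), by
    rw [map_smul, ← V.act_mul_apply, hea], (V.conjCoeff_coeff a x).symm⟩

/-- The coefficient of the normalization of a vector in the closure of `{a x | a ∈ B}` is a limit of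
the functionals `conjCoeff a (V.coeff x)`, `a ∈ B`. -/
theorem coeff_normalize_mem_closure {x y : V.carrier} (hy : y ≠ 0) {B : Set A}
    (hyB : y ∈ closure ((fun a => V.act a x) '' B)) {T : Set (A → ℂ)}
    (hT : ∀ a ∈ B, V.coeff x (star a * a) ≠ 0 → conjCoeff a (V.coeff x) ∈ closure T) :
    V.coeff (((‖y‖⁻¹ : ℝ) : ℂ) • y) ∈ closure T := by
  have hy' : y ∈ closure ({0}ᶜ ∩ (fun a => V.act a x) '' B) :=
    isOpen_compl_singleton.inter_closure ⟨hy, hyB⟩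
  have hc : ContinuousAt (fun z : V.carrier => V.coeff (((‖z‖⁻¹ : ℝ) : ℂ) • z)) y := by
    refine V.continuous_coeff.continuousAt.comp ?_
    refine ContinuousAt.smul ?_ continuousAt_id
    exact Complex.continuous_ofReal.continuousAt.comp
      (continuous_norm.continuousAt.inv₀ (norm_ne_zero_iff.2 hy))
  rw [← closure_closure]
  refine hc.continuousWithinAt.mem_closure hy' ?_
  rintro _ ⟨h0, a, ha, rfl⟩
  change V.coeff _ ∈ _
  rw [← conjCoeff_coeff]
  exact hT a ha (V.coeff_ne_zero_of_act_ne_zero h0)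

/-- The `a`-conjugates of limits of convex combinations of coefficients of `e`-fixed vectors are
again such limits, provided that `e a = a`. -/
theorem conjCoeff_mem_closure_convexHull {e a : A} (hea : e * a = a) {χ : A → ℂ}
    (hχ : χ ∈ closure (convexHull ℝ (V.fixedCoeffs e))) (h : χ (star a * a) ≠ 0) :
    conjCoeff a χ ∈ closure (convexHull ℝ (V.fixedCoeffs e)) := by
  -- On the convex hull `η(a* · a)` is a nonnegative multiple of an element of the convex hull.
  have key : convexHull ℝ (V.fixedCoeffs e) ⊆ {η | ∃ r : ℝ, 0 ≤ r ∧
      η (star a * a) = r ∧ (r ≠ 0 → conjCoeff a η ∈ convexHull ℝ (V.fixedCoeffs e)) ∧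
        (r = 0 → ∀ c, η (star a * c * a) = 0)} := by
    refine convexHull_min ?_ ?_
    · rintro _ ⟨x, hx, hex, rfl⟩
      refine ⟨‖V.act a x‖ ^ 2, by positivity, by rw [coeff_star_mul_self]; simp, fun h => ?_,
        fun h c => ?_⟩
      · refine subset_convexHull _ _ (V.conjCoeff_mem_fixedCoeffs hea ?_)
        rw [coeff_star_mul_self]
        exact_mod_cast h
      · have h0 : V.act a x = 0 := by simpa using h
        rw [← coeff_act, h0, coeff, inner_zero_left]
    · rintro η ⟨r, hr, hηr, h1, h2⟩ η' ⟨r', hr', hηr', h1', h2'⟩ s t hs ht hst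
      have hval : (s • η + t • η') (star a * a) = ((s * r + t * r' : ℝ) : ℂ) := by
        simp [hηr, hηr']
      refine ⟨s * r + t * r', by positivity, hval, fun h => ?_, fun h c => ?_⟩
      · have hpos : 0 < s * r + t * r' := lt_of_le_of_ne (by positivity) (Ne.symm h)
        -- The conjugate of `s η + t η'` is the combination of the conjugates with weights
        -- `s r / (s r + t r')` and `t r' / (s r + t r')`.
        have hcomb : conjCoeff a (s • η + t • η') =
            (s * r / (s * r + t * r')) • conjCoeff a η +
              (t * r' / (s * r + t * r')) • conjCoeff a η' := by
          funext c
          have h3 : ((s * r + t * r' : ℝ) : ℂ) ≠ 0 := Complex.ofReal_ne_zero.2 h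
          have e1 : ∀ (ρ : ℝ) (θ : A → ℂ), θ (star a * a) = ρ →
              (ρ = 0 → ∀ c, θ (star a * c * a) = 0) →
              θ (star a * c * a) = ρ * conjCoeff a θ c := by
            intro ρ θ hθ h0
            by_cases hρ : ρ = 0
            · rw [h0 hρ, hρ]; simp
            · rw [conjCoeff, hθ, mul_div_cancel₀ _ (Complex.ofReal_ne_zero.2 hρ)]
          rw [conjCoeff, hval, Pi.add_apply, Pi.smul_apply, Pi.smul_apply, e1 r η hηr h2,
            e1 r' η' hηr' h2', Pi.add_apply, Pi.smul_apply, Pi.smul_apply]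
          simp only [Complex.real_smul]
          rw [div_eq_iff h3]
          push_cast at h3 ⊢
          field_simp
        rw [hcomb]
        by_cases hr0 : s * r = 0
        · have htr : t * r' ≠ 0 := fun h' => h (by rw [hr0, h', add_zero])
          rw [hr0, zero_div, zero_smul, zero_add, zero_add, div_self htr, one_smul]
          exact h1' (right_ne_zero_of_mul htr)
        by_cases hr0' : t * r' = 0
        · rw [hr0', zero_div, zero_smul, add_zero, add_zero, div_self hr0, one_smul]
          exact h1 (right_ne_zero_of_mul hr0)
        · exact convex_convexHull ℝ _ (h1 (right_ne_zero_of_mul hr0))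
            (h1' (right_ne_zero_of_mul hr0')) (by positivity) (by positivity)
            (by rw [← add_div, div_self h])
      · have hsr : s * r = 0 := by
          have := mul_nonneg hs hr; have := mul_nonneg ht hr'; linarith
        have htr : t * r' = 0 := by
          have := mul_nonneg hs hr; have := mul_nonneg ht hr'; linarith
        have e1 : ∀ (σ ρ : ℝ) (θ : A → ℂ), σ * ρ = 0 →
            (ρ = 0 → ∀ c, θ (star a * c * a) = 0) → (σ • θ) (star a * c * a) = 0 := by
          intro σ ρ θ h0 h1
          rcases mul_eq_zero.1 h0 with h0 | h0
          · simp [h0]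
          · simp [h1 h0]
        rw [Pi.add_apply, e1 s r η hsr h2, e1 t r' η' htr h2', add_zero]
  refine conjCoeff_mem_closure h hχ fun η hη hη0 => ?_
  obtain ⟨r, -, hr, h1, -⟩ := key hη
  exact h1 fun h0 => hη0 (by rw [hr, h0, Complex.ofReal_zero])

end UnitaryRep

end Coefficients

/-! ### States and the Gelfand–Naimark–Segal construction -/

section States

variable {A : Type u} [NonUnitalRing A] [Module ℂ A] [StarRing A]

/-- A state of the corner `e A e`, regarded as the functional `a ↦ ψ(e a e)` on `A`, that is
bounded by `M` in the sense that `a` acts by an operator of norm at most `M a` on the associated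
pre-Hilbert space. The boundedness is part of the notion as `A` carries no norm. -/
structure IsState (e : A) (M : A → ℝ) (ψ : A → ℂ) : Prop where
  map_add : ∀ a b, ψ (a + b) = ψ a + ψ b
  map_smul : ∀ (c : ℂ) a, ψ (c • a) = c * ψ a
  map_star : ∀ a, ψ (star a) = star (ψ a)
  map_proj : ψ e = 1
  compress : ∀ a, ψ (e * a * e) = ψ a
  nonneg : ∀ a, 0 ≤ (ψ (star a * a)).re
  bound : ∀ a b, (ψ (star (a * b) * (a * b))).re ≤ M a ^ 2 * (ψ (star b * b)).re

theorem isClosed_setOf_isState (e : A) (M : A → ℝ) : IsClosed {ψ | IsState e M ψ} := by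
  have h : {ψ : A → ℂ | IsState e M ψ} =
      {ψ | ∀ a b, ψ (a + b) = ψ a + ψ b} ∩ {ψ | ∀ (c : ℂ) a, ψ (c • a) = c * ψ a} ∩
      {ψ | ∀ a, ψ (star a) = star (ψ a)} ∩ {ψ | ψ e = 1} ∩ {ψ | ∀ a, ψ (e * a * e) = ψ a} ∩
      {ψ | ∀ a, 0 ≤ (ψ (star a * a)).re} ∩
      {ψ | ∀ a b, (ψ (star (a * b) * (a * b))).re ≤ M a ^ 2 * (ψ (star b * b)).re} := by
    ext ψ
    exact ⟨fun h => ⟨⟨⟨⟨⟨⟨h.1, h.2⟩, h.3⟩, h.4⟩, h.5⟩, h.6⟩, h.7⟩,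
      fun ⟨⟨⟨⟨⟨⟨h1, h2⟩, h3⟩, h4⟩, h5⟩, h6⟩, h7⟩ => ⟨h1, h2, h3, h4, h5, h6, h7⟩⟩
  rw [h]
  simp only [Set.ofPred_forall]
  have hc : ∀ a : A, Continuous fun ψ : A → ℂ => ψ a := fun a => continuous_apply a
  have hre : ∀ a : A, Continuous fun ψ : A → ℂ => (ψ a).re := fun a =>
    Complex.continuous_re.comp (hc a)
  refine IsClosed.inter (IsClosed.inter (IsClosed.inter (IsClosed.inter (IsClosed.inter
    (IsClosed.inter ?_ ?_) ?_) ?_) ?_) ?_) ?_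
  · exact isClosed_iInter fun a => isClosed_iInter fun b =>
      isClosed_eq (hc _) ((hc _).add (hc _))
  · exact isClosed_iInter fun c => isClosed_iInter fun a =>
      isClosed_eq (hc _) (continuous_const.mul (hc _))
  · exact isClosed_iInter fun a => isClosed_eq (hc _) (hc _).star
  · exact isClosed_eq (hc _) continuous_const
  · exact isClosed_iInter fun a => isClosed_eq (hc _) (hc _)
  · exact isClosed_iInter fun a => isClosed_le continuous_const (hre _)
  · exact isClosed_iInter fun a => isClosed_iInter fun b =>
      isClosed_le (hre _) (continuous_const.mul (hre _))

theorem convex_setOf_isState (e : A) (M : A → ℝ) : Convex ℝ {ψ | IsState e M ψ} := by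
  rintro ψ h ψ' h' s t hs ht hst
  have hst' : (s : ℂ) + t = 1 := by exact_mod_cast hst
  have hv : ∀ a, (s • ψ + t • ψ') a = s * ψ a + t * ψ' a := fun a => by
    simp [Complex.real_smul]
  refine ⟨fun a b => ?_, fun c a => ?_, fun a => ?_, ?_, fun a => ?_, fun a => ?_, fun a b => ?_⟩
  · rw [hv, hv, hv, h.map_add, h'.map_add]; ring
  · rw [hv, hv, h.map_smul, h'.map_smul]; ring
  · rw [hv, hv, h.map_star, h'.map_star]; simp
  · rw [hv, h.map_proj, h'.map_proj, mul_one, mul_one, hst']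
  · rw [hv, hv, h.compress, h'.compress]
  · rw [hv]
    simpa using add_nonneg (mul_nonneg hs (h.nonneg a)) (mul_nonneg ht (h'.nonneg a))
  · rw [hv, hv]
    have h1 := mul_le_mul_of_nonneg_left (h.bound a b) hs
    have h2 := mul_le_mul_of_nonneg_left (h'.bound a b) ht
    simp only [Complex.add_re, Complex.re_ofReal_mul]
    linarith

namespace UnitaryRep

/-- The coefficient of a unit vector fixed by `e` is a state. -/
theorem isState_coeff (V : UnitaryRep A) {e : A} (he : IsStarProjection e) {M : A → ℝ}
    (hM : ∀ a x, ‖V.act a x‖ ≤ M a * ‖x‖) {x : V.carrier} (hx : ‖x‖ = 1) (hex : V.act e x = x) :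
    IsState e M (V.coeff x) where
  map_add a b := by rw [coeff, map_add]; exact inner_add_right _ _ _
  map_smul c a := by rw [coeff, map_smul]; exact inner_smul_right _ _ _
  map_star a := by
    rw [coeff, coeff, ← V.inner_act]
    exact (inner_conj_symm _ _).symm
  map_proj := by
    rw [coeff, hex, inner_self_eq_norm_sq_to_K, hx]; simp
  compress a := by
    have := V.coeff_act e x a
    rwa [he.isSelfAdjoint.star_eq, hex, eq_comm] at this
  nonneg a := by
    rw [coeff_star_mul_self, ← Complex.ofReal_pow, Complex.ofReal_re]
    positivity
  bound a b := by
    rw [coeff_star_mul_self, coeff_star_mul_self, ← Complex.ofReal_pow, ← Complex.ofReal_pow,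
      Complex.ofReal_re, Complex.ofReal_re, ← mul_pow, act_mul_apply]
    exact pow_le_pow_left₀ (norm_nonneg _) (hM _ _) 2

end UnitaryRep

namespace IsState

variable {e : A} {M : A → ℝ} {ψ : A → ℂ}

/-- The space `A` with the inner product `⟨a, b⟩ = ψ(a* b)` given by a state `ψ`; it is not
definite in general. -/
def PreGNS (_ : IsState e M ψ) : Type u := A

instance (h : IsState e M ψ) : AddCommGroup h.PreGNS := inferInstanceAs (AddCommGroup A)

instance (h : IsState e M ψ) : Module ℂ h.PreGNS := inferInstanceAs (Module ℂ A)

theorem apply_mul_proj (h : IsState e M ψ) (he : IsStarProjection e) (a : A) :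
    ψ (a * e) = ψ a := by
  rw [← h.compress (a * e), mul_assoc, mul_assoc, he.isIdempotentElem.eq, ← mul_assoc, h.compress]

theorem apply_proj_mul (h : IsState e M ψ) (he : IsStarProjection e) (a : A) :
    ψ (e * a) = ψ a := by
  rw [← h.compress (e * a), ← mul_assoc, he.isIdempotentElem.eq, h.compress]

variable [IsScalarTower ℂ A A] [StarModule ℂ A]

/-- The semi-definite inner product given by a state. -/
abbrev preGNSCore (h : IsState e M ψ) : PreInnerProductSpace.Core ℂ h.PreGNS where
  inner a b := ψ (star (show A from a) * (show A from b))
  conj_inner_symm a b := by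
    change star (ψ _) = ψ _
    rw [← h.map_star, star_mul, star_star]
  re_inner_nonneg a := h.nonneg a
  add_left a b c := by
    change ψ (star ((show A from a) + (show A from b)) * (show A from c)) = _
    rw [star_add, add_mul, h.map_add]
  smul_left a b c := by
    change ψ (star (c • (show A from a)) * (show A from b)) = _
    rw [star_smul, smul_mul_assoc, h.map_smul]
    rfl

instance (h : IsState e M ψ) : SeminormedAddCommGroup h.PreGNS :=
  InnerProductSpace.Core.toSeminormedAddCommGroup (c := h.preGNSCore)

instance (h : IsState e M ψ) : InnerProductSpace ℂ h.PreGNS :=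
  InnerProductSpace.ofCore h.preGNSCore

/-- The identity map from `A` to the pre-Hilbert space of a state. -/
def toPreGNS (h : IsState e M ψ) : A ≃ₗ[ℂ] h.PreGNS := LinearEquiv.refl ℂ A

theorem inner_toPreGNS (h : IsState e M ψ) (a b : A) :
    inner ℂ (h.toPreGNS a) (h.toPreGNS b) = ψ (star a * b) := rfl

theorem norm_toPreGNS_sq (h : IsState e M ψ) (a : A) :
    ‖h.toPreGNS a‖ ^ 2 = (ψ (star a * a)).re := by
  rw [← inner_toPreGNS h, ← inner_self_eq_norm_sq (𝕜 := ℂ)]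
  rfl

theorem norm_mul_le (h : IsState e M ψ) (a b : A) :
    ‖h.toPreGNS (a * b)‖ ≤ |M a| * ‖h.toPreGNS b‖ := by
  rw [← sq_le_sq₀ (norm_nonneg _) (by positivity), mul_pow, sq_abs, h.norm_toPreGNS_sq,
    h.norm_toPreGNS_sq]
  exact h.bound a b

theorem norm_apply_le (h : IsState e M ψ) (he : IsStarProjection e) (a : A) : ‖ψ a‖ ≤ |M a| := by
  have h1 : ‖h.toPreGNS e‖ = 1 := by
    rw [← sq_eq_sq₀ (norm_nonneg _) zero_le_one, h.norm_toPreGNS_sq, he.isSelfAdjoint.star_eq,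
      he.isIdempotentElem.eq, h.map_proj]
    simp
  have h2 : ψ a = inner ℂ (h.toPreGNS e) (h.toPreGNS (a * e)) := by
    rw [h.inner_toPreGNS, he.isSelfAdjoint.star_eq, ← mul_assoc, h.compress]
  rw [h2]
  refine (norm_inner_le_norm _ _).trans ?_
  have h3 := h.norm_mul_le a e
  rwa [h1, mul_one, ← one_mul ‖_‖, ← h1] at h3

/-- The image of an element of `A` in the Hilbert space of a state. -/
def toGNS (h : IsState e M ψ) : A →ₗ[ℂ] UniformSpace.Completion h.PreGNS :=
  (UniformSpace.Completion.toComplL (𝕜 := ℂ) (E := h.PreGNS)).toLinearMap ∘ₗ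
    h.toPreGNS.toLinearMap

theorem toGNS_apply (h : IsState e M ψ) (a : A) : h.toGNS a = (h.toPreGNS a : _) := rfl

theorem denseRange_toGNS (h : IsState e M ψ) : DenseRange h.toGNS :=
  UniformSpace.Completion.denseRange_coe.comp h.toPreGNS.surjective.denseRange
    (UniformSpace.Completion.continuous_coe _)

theorem inner_toGNS (h : IsState e M ψ) (a b : A) :
    inner ℂ (h.toGNS a) (h.toGNS b) = ψ (star a * b) := by
  rw [toGNS_apply, toGNS_apply, UniformSpace.Completion.inner_coe, inner_toPreGNS]

theorem ext_toGNS (h : IsState e M ψ)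
    {S T : UniformSpace.Completion h.PreGNS →L[ℂ] UniformSpace.Completion h.PreGNS}
    (hST : ∀ b, S (h.toGNS b) = T (h.toGNS b)) : S = T :=
  ContinuousLinearMap.ext fun x => congrFun (h.denseRange_toGNS.equalizer S.continuous
    T.continuous (funext hST)) x

/-- The state vanishes on `b (a e - a)` for all `b`, so that `a` and `a e` have the same image. -/
theorem toGNS_mul_proj (h : IsState e M ψ) (he : IsStarProjection e) (a : A) :
    h.toGNS (a * e) = h.toGNS a := by
  rw [← sub_eq_zero, ← inner_self_eq_zero (𝕜 := ℂ), ← map_sub, inner_toGNS]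
  have h1 : ∀ b, ψ (b * (a * e - a)) = 0 := fun b => by
    have h2 : b * (a * e - a) = b * a * e + (-1 : ℂ) • (b * a) := by
      rw [mul_sub, mul_assoc, neg_one_smul, sub_eq_add_neg]
    rw [h2, h.map_add, h.map_smul, h.apply_mul_proj he]; ring
  exact h1 _

variable [SMulCommClass ℂ A A]

/-- Left multiplication by `a` on the pre-Hilbert space of a state. -/
def mulLeft (h : IsState e M ψ) (a : A) : h.PreGNS →L[ℂ] h.PreGNS :=
  (h.toPreGNS.toLinearMap ∘ₗ LinearMap.mulLeft ℂ a ∘ₗ h.toPreGNS.symm.toLinearMap).mkContinuous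
    |M a| fun x => h.norm_mul_le a (h.toPreGNS.symm x)

theorem mulLeft_apply (h : IsState e M ψ) (a b : A) :
    h.mulLeft a (h.toPreGNS b) = h.toPreGNS (a * b) := rfl

theorem completion_mulLeft_toGNS (h : IsState e M ψ) (a b : A) :
    (h.mulLeft a).completion (h.toGNS b) = h.toGNS (a * b) := by
  rw [toGNS_apply, ContinuousLinearMap.completion_apply_coe, mulLeft_apply, toGNS_apply]

/-- The unitary representation given by a state. -/
def gns (hA : IsIdempotented A) (h : IsState e M ψ) : UnitaryRep A where
  carrier := UniformSpace.Completion h.PreGNS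
  act :=
    { toFun := fun a => (h.mulLeft a).completion
      map_smul' := fun c a => h.ext_toGNS fun b => by
        change _ = c • (h.mulLeft a).completion (h.toGNS b)
        rw [completion_mulLeft_toGNS, completion_mulLeft_toGNS, smul_mul_assoc, _root_.map_smul]
      map_zero' := h.ext_toGNS fun b => by
        rw [completion_mulLeft_toGNS, zero_mul, _root_.map_zero]; rfl
      map_add' := fun a b => h.ext_toGNS fun c => by
        change _ = (h.mulLeft a).completion (h.toGNS c) + (h.mulLeft b).completion (h.toGNS c)
        rw [completion_mulLeft_toGNS, completion_mulLeft_toGNS, completion_mulLeft_toGNS, add_mul,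
          _root_.map_add]
      map_mul' := fun a b => h.ext_toGNS fun c => by
        change _ = (h.mulLeft a).completion ((h.mulLeft b).completion (h.toGNS c))
        rw [completion_mulLeft_toGNS, completion_mulLeft_toGNS, completion_mulLeft_toGNS,
          mul_assoc] }
  inner_act a x y := by
    refine h.denseRange_toGNS.induction_on₂ (p := fun x y =>
      inner ℂ ((h.mulLeft a).completion x) y = inner ℂ x ((h.mulLeft (star a)).completion y))
      ?_ (fun b c => ?_) x y
    · exact isClosed_eq (((h.mulLeft a).completion.continuous.comp continuous_fst).inner
        continuous_snd)
        (continuous_fst.inner ((h.mulLeft (star a)).completion.continuous.comp continuous_snd))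
    · rw [completion_mulLeft_toGNS, completion_mulLeft_toGNS, inner_toGNS, inner_toGNS, star_mul,
        mul_assoc]
  dense_act := by
    refine h.denseRange_toGNS.mono ?_
    rintro _ ⟨b, rfl⟩
    obtain ⟨f, hf, hfb⟩ := hA {b}
    refine Submodule.subset_span ⟨f, h.toGNS b, ?_⟩
    change (h.mulLeft f).completion (h.toGNS b) = _
    rw [completion_mulLeft_toGNS]
    rw [hf.mul_eq_of_mul_mul_eq (hfb b (Finset.mem_singleton_self b))]

/-- The canonical cyclic vector of the representation given by a state. -/
def gnsVec (hA : IsIdempotented A) (h : IsState e M ψ) : (h.gns hA).carrier := h.toGNS e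

/-- Since the state vanishes on `a - e a e`, the elements `a` and `a e` have the same image. -/
theorem act_gnsVec (hA : IsIdempotented A) (h : IsState e M ψ) (a : A) :
    (h.gns hA).act a (h.gnsVec hA) = h.toGNS (a * e) := h.completion_mulLeft_toGNS a e

theorem act_gnsVec_eq (hA : IsIdempotented A) (h : IsState e M ψ) (he : IsStarProjection e)
    (a : A) : (h.gns hA).act a (h.gnsVec hA) = h.toGNS a :=
  (h.act_gnsVec hA a).trans (h.toGNS_mul_proj he a)

theorem act_proj_gnsVec (hA : IsIdempotented A) (h : IsState e M ψ) (he : IsStarProjection e) :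
    (h.gns hA).act e (h.gnsVec hA) = h.gnsVec hA := h.act_gnsVec_eq hA he e

theorem denseRange_act_gnsVec (hA : IsIdempotented A) (h : IsState e M ψ)
    (he : IsStarProjection e) : DenseRange fun a => (h.gns hA).act a (h.gnsVec hA) := by
  have := h.denseRange_toGNS
  rwa [← funext (h.act_gnsVec_eq hA he)] at this

theorem coeff_gnsVec (hA : IsIdempotented A) (h : IsState e M ψ) (he : IsStarProjection e) :
    (h.gns hA).coeff (h.gnsVec hA) = ψ := by
  funext a
  rw [UnitaryRep.coeff, h.act_gnsVec_eq hA he]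
  refine (h.inner_toGNS e a).trans ?_
  rw [he.isSelfAdjoint.star_eq, h.apply_proj_mul he]

theorem norm_gnsVec (hA : IsIdempotented A) (h : IsState e M ψ) (he : IsStarProjection e) :
    ‖h.gnsVec hA‖ = 1 := by
  have h1 : (‖h.gnsVec hA‖ : ℂ) ^ 2 = 1 := by
    rw [← h.act_proj_gnsVec hA he, ← UnitaryRep.coeff_star_mul_self, h.coeff_gnsVec hA he,
      he.isSelfAdjoint.star_eq, he.isIdempotentElem.eq, h.map_proj]
  have h2 : ‖h.gnsVec hA‖ ^ 2 = 1 := by exact_mod_cast h1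
  exact (pow_eq_one_iff_of_nonneg (norm_nonneg _) two_ne_zero).1 h2

end IsState

variable [IsScalarTower ℂ A A] [StarModule ℂ A]

theorem isCompact_setOf_isState {e : A} (he : IsStarProjection e) (M : A → ℝ) :
    IsCompact {ψ | IsState e M ψ} := by
  refine (isCompact_univ_pi fun a => isCompact_closedBall (0 : ℂ) |M a|).of_isClosed_subset
    (isClosed_setOf_isState e M) fun ψ h a _ => ?_
  rw [mem_closedBall_zero_iff]
  exact IsState.norm_apply_le h he a

end States

/-! ### Irreducible representations and pure states -/

section Irreducible

variable {A : Type u} [NonUnitalRing A] [Module ℂ A] [StarRing A]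

namespace UnitaryRep

variable {V : UnitaryRep A}

/-- **Schur's lemma** for self-adjoint operators: otherwise the spectrum of `T` has two points, and
functions `f`, `g` with `f g = 0` that do not vanish at them give a closed submodule
`ker f(T) ⊇ im g(T)`. -/
theorem IsIrreducible.exists_eq_smul (hV : V.IsIrreducible) {T : V.carrier →L[ℂ] V.carrier}
    (hT : IsSelfAdjoint T) (hTA : ∀ a x, T (V.act a x) = V.act a (T x)) :
    ∃ c : ℝ, ∀ x, T x = (c : ℂ) • x := by
  suffices h : (spectrum ℝ T).Subsingleton by
    obtain ⟨c, hc⟩ : ∃ c, spectrum ℝ T ⊆ {c} := by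
      rcases h.eq_empty_or_singleton with h | ⟨c, h⟩
      · exact ⟨0, by rw [h]; exact Set.empty_subset _⟩
      · exact ⟨c, h.subset⟩
    have h1 := CFC.eq_algebraMap_of_spectrum_subset_singleton T c hc
    refine ⟨c, fun x => ?_⟩
    conv_lhs => rw [h1]
    rw [Algebra.algebraMap_eq_smul_one]
    rfl
  suffices h : ∀ r ∈ spectrum ℝ T, ∀ r' ∈ spectrum ℝ T, ¬ r < r' from
    fun r hr r' hr' => le_antisymm (not_lt.1 (h r' hr' r hr)) (not_lt.1 (h r hr r' hr'))
  intro r hr r' hr' hlt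
  let f : ℝ → ℝ := fun x => max ((r + r') / 2 - x) 0
  let g : ℝ → ℝ := fun x => max (x - (r + r') / 2) 0
  have hf : Continuous f := by fun_prop
  have hg : Continuous g := by fun_prop
  have hne : ∀ (k : ℝ → ℝ), Continuous k → ∀ p ∈ spectrum ℝ T, k p ≠ 0 → cfc k T ≠ 0 := by
    intro k hk p hp hkp h0
    have h1 : k p ∈ spectrum ℝ (cfc k T) := by
      rw [cfc_map_spectrum k T]
      exact ⟨p, hp, rfl⟩
    rw [h0] at h1
    have := hV.1
    rw [spectrum.zero_eq] at h1
    exact hkp h1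
  have hfT := hne f hf r hr (by
    have : (0 : ℝ) < (r + r') / 2 - r := by linarith
    exact (lt_max_of_lt_left this).ne')
  have hgT := hne g hg r' hr' (by
    have : (0 : ℝ) < r' - (r + r') / 2 := by linarith
    exact (lt_max_of_lt_left this).ne')
  have hfg : cfc f T * cfc g T = 0 := by
    rw [← cfc_mul f g T hf.continuousOn hg.continuousOn]
    have : (fun x => f x * g x) = fun _ => (0 : ℝ) := by
      funext x
      rcases le_total x ((r + r') / 2) with h | h
      · have : g x = 0 := max_eq_right (by linarith)
        rw [this, mul_zero]
      · have : f x = 0 := max_eq_right (by linarith)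
        rw [this, zero_mul]
    rw [this, cfc_const_zero]
  have hcomm : ∀ a, Commute (cfc f T) (V.act a) := fun a =>
    Commute.cfc_real (ContinuousLinearMap.ext fun x => hTA a x) f
  rcases hV.2 (LinearMap.ker (cfc f T).toLinearMap) (cfc f T).isClosed_ker (fun a x hx => by
    have h1 : cfc f T x = 0 := hx
    have h2 : cfc f T (V.act a x) = V.act a (cfc f T x) :=
      congrArg (fun S : V.carrier →L[ℂ] V.carrier => S x) (hcomm a).eq
    change cfc f T (V.act a x) = 0
    rw [h2, h1, map_zero]) with h | h
  · refine hgT (ContinuousLinearMap.ext fun x => ?_)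
    have h1 : cfc g T x ∈ LinearMap.ker (cfc f T).toLinearMap :=
      congrArg (fun S : V.carrier →L[ℂ] V.carrier => S x) hfg
    rw [h] at h1
    exact h1
  · refine hfT (ContinuousLinearMap.ext fun x => ?_)
    have h1 : x ∈ LinearMap.ker (cfc f T).toLinearMap := by rw [h]; trivial
    exact h1

theorem IsIrreducible.denseRange_act (hV : V.IsIrreducible) {e : A} {x : V.carrier}
    (hx : x ≠ 0) (hex : V.act e x = x) : DenseRange fun a => V.act a x := by
  let f : A →ₗ[ℂ] V.carrier :=
    { toFun := fun a => V.act a x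
      map_add' := fun a b => by rw [map_add]; rfl
      map_smul' := fun c a => by rw [map_smul]; rfl }
  have hxf : x ∈ (LinearMap.range f).topologicalClosure :=
    Submodule.le_topologicalClosure _ ⟨e, hex⟩
  rcases hV.2 (LinearMap.range f).topologicalClosure (Submodule.isClosed_topologicalClosure _)
    (fun a y hy => by
      refine map_mem_closure (V.act a).continuous hy ?_
      rintro _ ⟨b, rfl⟩
      exact ⟨a * b, V.act_mul_apply a b x⟩) with h | h
  · rw [h] at hxf
    exact absurd hxf hx
  · intro y
    have hy : y ∈ (LinearMap.range f).topologicalClosure := by rw [h]; trivial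
    exact hy

/-- The orthogonal projection to a closed submodule commutes with the action. -/
theorem act_starProjection (U : Submodule ℂ V.carrier) [U.HasOrthogonalProjection]
    (hU : ∀ a, ∀ x ∈ U, V.act a x ∈ U) (a : A) (x : V.carrier) :
    U.starProjection (V.act a x) = V.act a (U.starProjection x) := by
  refine Submodule.eq_starProjection_of_mem_of_inner_eq_zero
    (hU a _ (U.starProjection_apply_mem x)) fun w hw => ?_
  rw [← map_sub, V.inner_act]
  exact Submodule.starProjection_inner_eq_zero x _ (hU _ w hw)

variable [IsScalarTower ℂ A A] [SMulCommClass ℂ A A] [StarModule ℂ A]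

/-- Coefficients of irreducible representations are pure states: a state `ψ` that is dominated by
such a coefficient gives an intertwiner `R` to the representation of `ψ`, and `R* R` is a scalar by
Schur's lemma. -/
theorem IsIrreducible.coeff_mem_extremePoints (hA : IsIdempotented A) (hV : V.IsIrreducible)
    {e : A} {M : A → ℝ} (he : IsStarProjection e) {x : V.carrier} (hx : ‖x‖ = 1)
    (hex : V.act e x = x) (hS : IsState e M (V.coeff x)) :
    V.coeff x ∈ Set.extremePoints ℝ {ψ | IsState e M ψ} := by
  refine mem_extremePoints_iff_left.2 ⟨hS, ?_⟩
  rintro ψ (h : IsState e M ψ) ψ' (h' : IsState e M ψ') ⟨s, t, hs, ht, -, hst⟩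
  have hx0 : x ≠ 0 := by
    rintro rfl
    simp at hx
  let f : A →ₗ[ℂ] V.carrier :=
    { toFun := fun a => V.act a x
      map_add' := fun a b => by rw [_root_.map_add]; rfl
      map_smul' := fun c a => by rw [_root_.map_smul]; rfl }
  have hfd : DenseRange f := hV.denseRange_act hx0 hex
  have hnorm : ∃ C, ∀ a, ‖h.toGNS a‖ ≤ C * ‖f a‖ := by
    refine ⟨√(s⁻¹), fun a => ?_⟩
    rw [← sq_le_sq₀ (norm_nonneg _) (by positivity), mul_pow, Real.sq_sqrt (by positivity)]
    have h1 : ‖h.toGNS a‖ ^ 2 = (ψ (star a * a)).re := by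
      rw [← inner_self_eq_norm_sq (𝕜 := ℂ), h.inner_toGNS]; rfl
    have h2 : ‖f a‖ ^ 2 = (V.coeff x (star a * a)).re := by
      rw [V.coeff_star_mul_self, ← Complex.ofReal_pow, Complex.ofReal_re]; rfl
    have h3 : (V.coeff x (star a * a)).re =
        s * (ψ (star a * a)).re + t * (ψ' (star a * a)).re := by
      rw [← hst]; simp
    rw [h1, h2, h3, inv_mul_eq_div, le_div_iff₀ hs, mul_comm]
    have := mul_nonneg ht.le (h'.nonneg a)
    linarith
  let R : V.carrier →L[ℂ] (h.gns hA).carrier := h.toGNS.extendOfNorm f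
  have hR : ∀ a, R (V.act a x) = h.toGNS a := fun a =>
    LinearMap.extendOfNorm_eq hfd hnorm a
  have hRA : ∀ a y, R (V.act a y) = (h.gns hA).act a (R y) := by
    intro a y
    refine congrFun (hfd.equalizer (R.continuous.comp (V.act a).continuous)
      (((h.gns hA).act a).continuous.comp R.continuous) (funext fun b => ?_)) y
    change R (V.act a (V.act b x)) = (h.gns hA).act a (R (V.act b x))
    rw [← V.act_mul_apply, hR, hR]
    exact (h.completion_mulLeft_toGNS a b).symm
  obtain ⟨c, hc⟩ := hV.exists_eq_smul (T := R.adjoint ∘L R)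
    (ContinuousLinearMap.isSelfAdjoint_iff_isSymmetric.2 fun y z => by
      change inner ℂ (R.adjoint (R y)) z = inner ℂ y (R.adjoint (R z))
      rw [ContinuousLinearMap.adjoint_inner_left, ContinuousLinearMap.adjoint_inner_right])
    (fun a y => ext_inner_left ℂ fun z => by
      change inner ℂ z (R.adjoint (R (V.act a y))) = inner ℂ z (V.act a (R.adjoint (R y)))
      rw [ContinuousLinearMap.adjoint_inner_right, hRA]
      conv_rhs => rw [← star_star a]
      rw [← V.inner_act, ContinuousLinearMap.adjoint_inner_right, hRA, UnitaryRep.inner_act,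
        star_star])
  have hψ : ∀ a, ψ a = c * V.coeff x a := fun a => by
    have h1 : ψ a = inner ℂ (h.toGNS e) (h.toGNS a) := by
      rw [h.inner_toGNS, he.isSelfAdjoint.star_eq, h.apply_proj_mul he]
    rw [h1, ← hR, ← hR, hex]
    have h2 := ContinuousLinearMap.adjoint_inner_right R x (R (V.act a x))
    refine h2.symm.trans ?_
    have h3 : R.adjoint (R (V.act a x)) = (c : ℂ) • V.act a x := hc _
    rw [h3, inner_smul_right, coeff]
  have hc1 : (c : ℂ) = 1 := by
    have := hψ e
    rwa [h.map_proj, hS.map_proj, mul_one, eq_comm] at this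
  funext a
  rw [hψ, hc1, one_mul]

end UnitaryRep

namespace IsState

variable [IsScalarTower ℂ A A] [SMulCommClass ℂ A A] [StarModule ℂ A]
  {e : A} {M : A → ℝ} {ψ : A → ℂ}

/-- The representation of an extreme point `ψ` of the closed convex hull of the coefficients of `V'`
is irreducible: a closed submodule would decompose the cyclic vector into orthogonal components, and
thus `ψ` into a convex combination of two limits of conjugates of `ψ`. -/
theorem isIrreducible_gns (hA : IsIdempotented A) (he : IsStarProjection e) (V' : UnitaryRep A)
    (h : IsState e M ψ)
    (hψ : ψ ∈ Set.extremePoints ℝ (closure (convexHull ℝ (V'.fixedCoeffs e)))) :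
    (h.gns hA).IsIrreducible := by
  set W := h.gns hA with hW
  set ξ : W.carrier := h.gnsVec hA with hξ
  have hξ1 : ‖ξ‖ = 1 := h.norm_gnsVec hA he
  have hξe : W.act e ξ = ξ := h.act_proj_gnsVec hA he
  have hξd : DenseRange fun a => W.act a ξ := h.denseRange_act_gnsVec hA he
  have hξc : W.coeff ξ = ψ := h.coeff_gnsVec hA he
  have hξ0 : ξ ≠ 0 := by
    intro h0
    rw [h0, norm_zero] at hξ1
    exact zero_ne_one hξ1
  refine ⟨⟨ξ, 0, hξ0⟩, fun U hUc hU => ?_⟩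
  have : CompleteSpace U := hUc.completeSpace_coe
  have hUtop : ξ ∈ U → U = ⊤ := fun hξU => by
    refine Submodule.eq_top_iff'.2 fun y => ?_
    exact hUc.closure_subset_iff.2 (by rintro _ ⟨a, rfl⟩; exact hU a ξ hξU) (hξd y)
  set x₁ := U.starProjection ξ with hx₁
  set x₂ := ξ - U.starProjection ξ with hx₂
  have hsum : ξ = x₁ + x₂ := by rw [hx₁, hx₂]; abel
  have hx₁U : x₁ ∈ U := U.starProjection_apply_mem ξ
  by_cases h1 : x₁ = 0
  · left
    rw [Submodule.eq_bot_iff]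
    intro y hy
    have h2 : U.starProjection y = y := Submodule.starProjection_eq_self_iff.2 hy
    rw [← h2]
    refine congrFun (hξd.equalizer U.starProjection.continuous continuous_const
      (funext fun a => ?_)) y
    change U.starProjection (W.act a ξ) = 0
    rw [UnitaryRep.act_starProjection U hU, ← hx₁, h1, map_zero]
  by_cases h2 : x₂ = 0
  · right
    refine hUtop ?_
    rw [hsum, h2, add_zero]
    exact hx₁U
  exfalso
  have hortho : ∀ a, ∀ y ∈ U, inner ℂ y (W.act a x₂) = 0 := fun a y hy => by
    rw [← star_star a, ← W.inner_act, ← inner_conj_symm, Submodule.starProjection_inner_eq_zero ξ _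
      (hU _ y hy), map_zero]
  have hortho' : ∀ a, ∀ y ∈ U, inner ℂ x₂ (W.act a y) = 0 := fun a y hy =>
    Submodule.starProjection_inner_eq_zero ξ _ (hU _ y hy)
  have hex₁ : W.act e x₁ = x₁ := by
    rw [hx₁, ← UnitaryRep.act_starProjection U hU, hξe]
  have hex₂ : W.act e x₂ = x₂ := by
    rw [hx₂, map_sub, hξe, ← hx₁, hex₁]
  -- Normalized `e`-fixed vectors have coefficients in the closed convex hull.
  have hmem : ∀ y, y ≠ 0 → W.act e y = y → W.coeff (((‖y‖⁻¹ : ℝ) : ℂ) • y) ∈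
      closure (convexHull ℝ (V'.fixedCoeffs e)) := by
    intro y hy hey
    refine W.coeff_normalize_mem_closure (x := ξ) hy (B := {a | e * a = a}) ?_ fun a ha h0 => ?_
    · rw [← hey]
      refine map_mem_closure (W.act e).continuous (hξd y) ?_
      rintro _ ⟨a, rfl⟩
      refine ⟨e * a, ?_, W.act_mul_apply e a ξ⟩
      change e * (e * a) = e * a
      rw [← mul_assoc, he.isIdempotentElem.eq]
    · rw [hξc] at h0 ⊢
      exact V'.conjCoeff_mem_closure_convexHull ha hψ.1 h0
  have hsq : ‖x₁‖ ^ 2 + ‖x₂‖ ^ 2 = 1 := by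
    have h3 : inner ℂ x₁ x₂ = 0 := by
      rw [← hex₂]; exact hortho e x₁ hx₁U
    have h4 := norm_add_sq_eq_norm_sq_add_norm_sq_of_inner_eq_zero x₁ x₂ h3
    rw [← hsum, hξ1] at h4
    linarith
  have hdec : ∀ a, ψ a = W.coeff x₁ a + W.coeff x₂ a := fun a => by
    rw [← hξc]
    conv_lhs => rw [hsum]
    rw [UnitaryRep.coeff, _root_.map_add, inner_add_left, inner_add_right, inner_add_right,
      hortho a x₁ hx₁U, hortho' a x₁ hx₁U, add_zero, zero_add]
    rfl
  have hn : ∀ y : W.carrier, y ≠ 0 → (‖y‖ : ℂ) ^ 2 ≠ 0 := fun y hy =>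
    pow_ne_zero 2 (Complex.ofReal_ne_zero.2 (norm_ne_zero_iff.2 hy))
  have hpos : ∀ y : W.carrier, y ≠ 0 → 0 < ‖y‖ ^ 2 := fun y hy =>
    pow_pos (norm_pos_iff.2 hy) 2
  have heq := (mem_extremePoints_iff_left.1 hψ).2 _ (hmem x₁ h1 hex₁) _ (hmem x₂ h2 hex₂)
    ⟨‖x₁‖ ^ 2, ‖x₂‖ ^ 2, hpos x₁ h1, hpos x₂ h2, hsq, by
      funext a
      rw [Pi.add_apply, Pi.smul_apply, Pi.smul_apply, W.coeff_normalize, W.coeff_normalize,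
        Complex.real_smul, Complex.real_smul, Complex.ofReal_pow, Complex.ofReal_pow,
        mul_div_cancel₀ _ (hn x₁ h1), mul_div_cancel₀ _ (hn x₂ h2), hdec]⟩
  -- By extremality `⟨x₁, a ξ⟩ = ‖x₁‖² ⟨ξ, a ξ⟩` for all `a`, and the vectors `a ξ` are dense.
  have hx₁ξ : x₁ = ((‖x₁‖ : ℂ) ^ 2) • ξ := by
    rw [← sub_eq_zero]
    refine hξd.eq_zero_of_inner_left ℂ ?_
    intro a
    have h3 : inner ℂ x₁ (W.act a ξ) = W.coeff x₁ a := by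
      conv_lhs => rw [hsum]
      rw [_root_.map_add, inner_add_right, hortho a x₁ hx₁U, add_zero]
      rfl
    have h4 := congrFun heq a
    rw [W.coeff_normalize, div_eq_iff (hn x₁ h1), ← hξc] at h4
    change inner ℂ (x₁ - _) (W.act a ξ) = 0
    rw [inner_sub_left, h3, h4, inner_smul_left, UnitaryRep.coeff]
    simp [mul_comm]
  refine h2 ?_
  have hξU : ξ ∈ U := by
    have h5 : ξ = ((‖x₁‖ : ℂ) ^ 2)⁻¹ • x₁ := by
      conv_rhs => rw [hx₁ξ]
      rw [smul_smul]
      have h6 : ‖((‖x₁‖ : ℂ) ^ 2) • ξ‖ = ‖x₁‖ := by rw [← hx₁ξ]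
      rw [h6, inv_mul_cancel₀ (hn x₁ h1), one_smul]
    rw [h5]
    exact U.smul_mem _ hx₁U
  rw [hx₂, Submodule.starProjection_eq_self_iff.2 hξU, sub_self]

/-- The representation of a limit of coefficients of `V'` is weakly contained in `V'`. -/
theorem weaklyContained_gns (hA : IsIdempotented A) (he : IsStarProjection e) (V' : UnitaryRep A)
    (h : IsState e M ψ) (hψ : ψ ∈ closure (V'.fixedCoeffs e)) :
    (h.gns hA).WeaklyContained V' := by
  refine UnitaryRep.weaklyContained_iff.2 fun x hx => ?_
  have hx0 : x ≠ 0 := by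
    rintro rfl
    simp at hx
  have h1 := (h.gns hA).coeff_normalize_mem_closure (x := h.gnsVec hA) (B := Set.univ) hx0
    (by rw [Set.image_univ]; exact h.denseRange_act_gnsVec hA he x)
    (T := V'.unitCoeffs) (fun a _ h0 => by
      rw [h.coeff_gnsVec hA he] at h0 ⊢
      refine conjCoeff_mem_closure h0 hψ ?_
      rintro _ ⟨y, -, -, rfl⟩ hy
      exact V'.conjCoeff_mem_unitCoeffs hy)
  rwa [hx, inv_one, Complex.ofReal_one, one_smul] at h1

end IsState

end Irreducible

/-! ### Weak approximation and the topology of the unitary dual -/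

section Dual

variable {A : Type u} [NonUnitalRing A] [Module ℂ A] [StarRing A]

/-- The coefficient of a single cyclic vector controls the topology of the unitary dual near `[V]`:
all vectors of `V` are approximated by the vectors `b x`, whose coefficients are
`φ_{V,x}(b* · b)`. -/
theorem IrrRep.exists_mem_nhds_coeff (V : IrrRep A) {x : V.1.carrier}
    (hx : DenseRange fun a => V.1.act a x) {O : Set (UnitaryDual A)} (hO : IsOpen O)
    (hVO : V.toDual ∈ O) :
    ∃ N ∈ nhds (V.1.coeff x), ∀ (U : IrrRep A) (y : U.1.carrier), U.1.coeff y ∈ N →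
      U.toDual ∈ O := by
  induction hO with
  | basic O hO =>
    obtain ⟨V₀, x₀, ε, s, -, -, rfl⟩ := hO
    obtain ⟨U₀, hU₀, y₀, hy₀⟩ := hVO
    obtain ⟨T, hT⟩ : U₀.1.UnitarilyEquiv V.1 := Quotient.exact hU₀
    have hTy : ∀ a, V.1.coeff (T y₀) a = U₀.1.coeff y₀ a := fun a => by
      rw [UnitaryRep.coeff, ← hT, T.inner_map_map, UnitaryRep.coeff]
    let D : Set V.1.carrier := {z | ∀ a ∈ s, ‖V₀.1.coeff x₀ a - V.1.coeff z a‖ < ε}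
    have hD : IsOpen D := by
      have : D = ⋂ a ∈ s, {z | ‖V₀.1.coeff x₀ a - V.1.coeff z a‖ < ε} := by
        ext z; simp [D]
      rw [this]
      exact isOpen_biInter_finset fun a _ => isOpen_lt (continuous_const.sub
        ((continuous_apply a).comp V.1.continuous_coeff)).norm continuous_const
    obtain ⟨b, hb⟩ := hx.exists_mem_open hD ⟨T y₀, fun a ha => by rw [hTy]; exact hy₀ a ha⟩
    refine ⟨{χ | ∀ a ∈ s, ‖V₀.1.coeff x₀ a - χ (star b * a * b)‖ < ε}, ?_, fun U y hy =>
      ⟨U, rfl, U.1.act b y, fun a ha => by rw [UnitaryRep.coeff_act]; exact hy a ha⟩⟩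
    refine IsOpen.mem_nhds ?_ fun a ha => by rw [← UnitaryRep.coeff_act]; exact hb a ha
    have : {χ : A → ℂ | ∀ a ∈ s, ‖V₀.1.coeff x₀ a - χ (star b * a * b)‖ < ε} =
        ⋂ a ∈ s, {χ | ‖V₀.1.coeff x₀ a - χ (star b * a * b)‖ < ε} := by
      ext z; simp
    rw [this]
    exact isOpen_biInter_finset fun a _ => isOpen_lt (continuous_const.sub
      (continuous_apply _)).norm continuous_const
  | univ => exact ⟨Set.univ, Filter.univ_mem, fun _ _ _ => trivial⟩
  | inter O O' _ _ ih ih' =>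
    obtain ⟨N, hN, h⟩ := ih hVO.1
    obtain ⟨N', hN', h'⟩ := ih' hVO.2
    exact ⟨N ∩ N', Filter.inter_mem hN hN', fun U y hy => ⟨h U y hy.1, h' U y hy.2⟩⟩
  | sUnion S _ ih =>
    obtain ⟨O, hOS, hVO⟩ := hVO
    obtain ⟨N, hN, h⟩ := ih O hOS hVO
    exact ⟨N, hN, fun U y hy => ⟨O, hOS, h U y hy⟩⟩

variable [IsScalarTower ℂ A A] [SMulCommClass ℂ A A] [StarModule ℂ A]

/-- **Fell's approximation theorem**: if the coefficients of an irreducible representation `V` are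
limits of coefficients of the uniformly bounded representations `V' i`, then `[V]` is a limit of
classes of irreducible representations each of which is weakly contained in some `V' i`. -/
theorem IrrRep.toDual_mem_closure_iUnion_spec (hA : IsIdempotented A) (V : IrrRep A) {ι : Type w}
    (V' : ι → UnitaryRep A) (M : A → ℝ) (hM : ∀ i a y, ‖(V' i).act a y‖ ≤ M a * ‖y‖)
    (hV : ∀ x, ‖x‖ = 1 → V.1.coeff x ∈ closure (⋃ i, Set.range (V' i).coeff)) :
    V.toDual ∈ closure (⋃ i, (V' i).spec) := by
  -- A projection `e ∈ A` and a unit vector `x` of `V` with `e x = x`.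
  obtain ⟨e, he, x, hx, hex⟩ : ∃ e : A, IsStarProjection e ∧ ∃ x : V.1.carrier, ‖x‖ = 1 ∧
      V.1.act e x = x := by
    have := V.2.1
    obtain ⟨z, hz⟩ := exists_ne (0 : V.1.carrier)
    obtain ⟨_, hy0, a, y, rfl⟩ := (V.1.dense_range_act hA).inter_open_nonempty _
      isOpen_compl_singleton ⟨z, hz⟩
    obtain ⟨e, he, hea⟩ := hA {a}
    refine ⟨e, he, _, V.1.norm_normalize hy0, ?_⟩
    rw [map_smul, ← UnitaryRep.act_mul_apply,
      he.mul_eq_of_mul_mul_eq (hea a (Finset.mem_singleton_self a))]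
  have hx0 : x ≠ 0 := by
    rintro rfl
    simp at hx
  have hcyc := V.2.denseRange_act hx0 hex
  set S : Set (A → ℂ) := {ψ | IsState e M ψ} with hSdef
  have hS : IsCompact S := isCompact_setOf_isState he M
  have hS' : Convex ℝ S := convex_setOf_isState e M
  have hTS : ∀ i, (V' i).fixedCoeffs e ⊆ S := by
    rintro i _ ⟨y, hy, hey, rfl⟩
    exact (V' i).isState_coeff he (hM i) hy hey
  have hφ : V.1.coeff x ∈ closure (⋃ i, (V' i).fixedCoeffs e) := by
    have h1 : V.1.act e x ≠ 0 := by rwa [hex]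
    have h2 : conjCoeff e (V.1.coeff x) = V.1.coeff x := by
      rw [V.1.conjCoeff_coeff, hex, hx, inv_one, Complex.ofReal_one, one_smul]
    rw [← h2]
    refine conjCoeff_mem_closure (V.1.coeff_ne_zero_of_act_ne_zero h1) (hV x hx) ?_
    intro η hη hη0
    obtain ⟨i, y, rfl⟩ := Set.mem_iUnion.1 hη
    exact Set.mem_iUnion.2 ⟨i, (V' i).conjCoeff_mem_fixedCoeffs he.isIdempotentElem.eq hη0⟩
  have hφS : V.1.coeff x ∈ S := closure_minimal (Set.iUnion_subset hTS) hS.isClosed hφ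
  have hφext := V.2.coeff_mem_extremePoints hA he hx hex hφS
  let Q : ι → Set (A → ℂ) := fun i => closure (convexHull ℝ ((V' i).fixedCoeffs e))
  have hQS : ∀ i, Q i ⊆ S := fun i => closure_minimal (convexHull_min (hTS i) hS') hS.isClosed
  have hQ : ∀ i, IsCompact (Q i) := fun i => hS.of_isClosed_subset isClosed_closure (hQS i)
  have hQ' : ∀ i, Convex ℝ (Q i) := fun i => (convex_convexHull ℝ _).closure
  have hE : V.1.coeff x ∈ closure (⋃ i, (Q i).extremePoints ℝ) := by
    refine mem_closure_of_mem_extremePoints hS hS'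
      (Set.iUnion_subset fun i => extremePoints_subset.trans (hQS i)) hφext ?_
    refine closure_minimal (Set.iUnion_subset fun i => ?_) isClosed_closure hφ
    calc (V' i).fixedCoeffs e ⊆ Q i := (subset_convexHull ℝ _).trans subset_closure
      _ = closure (convexHull ℝ ((Q i).extremePoints ℝ)) :=
        (closure_convexHull_extremePoints (hQ i) (hQ' i)).symm
      _ ⊆ _ := closure_mono (convexHull_mono
        (Set.subset_iUnion (fun i => (Q i).extremePoints ℝ) i))
  refine mem_closure_iff.2 fun O hO hVO => ?_
  obtain ⟨N, hN, h⟩ := V.exists_mem_nhds_coeff hcyc hO hVO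
  obtain ⟨ψ, hψN, hψ⟩ := mem_closure_iff_nhds.1 hE N hN
  obtain ⟨i, hi⟩ := Set.mem_iUnion.1 hψ
  have hψS : IsState e M ψ := hQS i hi.1
  let W : IrrRep A := ⟨hψS.gns hA, hψS.isIrreducible_gns hA he (V' i) hi⟩
  refine ⟨W.toDual, h W (hψS.gnsVec hA) (by rwa [hψS.coeff_gnsVec hA he]),
    Set.mem_iUnion.2 ⟨i, W, rfl, ?_⟩⟩
  exact hψS.weaklyContained_gns hA he (V' i) (mem_closure_of_mem_extremePoints (hQ i) (hQ' i)
    ((subset_convexHull ℝ _).trans subset_closure) hi hi.1)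

end Dual

/-! ### Balls in complexes and compact subsets of the group -/

section Balls

variable {V : Type v} {K : AbstractSimplicialComplex V}

theorem CellDistLE.mono {x y : Finset V} {m n : ℕ} (h : CellDistLE K x y m) (hmn : m ≤ n) :
    CellDistLE K x y n :=
  h.imp id fun ⟨t, c, ht, h⟩ => ⟨t, c, ht.trans hmn, h⟩

theorem IsLocallyFiniteComplex.finite_vertexBall (hK : IsLocallyFiniteComplex K) (p : V) (n : ℕ) :
    (vertexBall K p n).Finite := by
  -- The last cells of the chains of length `t + 1` that start at `p`.
  let R : ℕ → Set (Finset V) := fun t => {y | ∃ c : ℕ → Finset V, (∀ i ≤ t, c i ∈ K) ∧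
    {p} ⊆ c 0 ∧ c t = y ∧ ∀ i < t, ∃ q, q ∈ c i ∧ q ∈ c (i + 1)}
  have hR : ∀ t, (R t).Finite := by
    intro t
    induction t with
    | zero =>
      refine (hK _ (K.singleton_mem p)).subset ?_
      rintro _ ⟨c, hc, hp, rfl, -⟩
      exact ⟨hc 0 le_rfl, hp⟩
    | succ t ih =>
      refine (ih.biUnion fun y _ => y.finite_toSet.biUnion fun q _ =>
        hK _ (K.singleton_mem q)).subset ?_
      rintro _ ⟨c, hc, hp, rfl, h⟩
      obtain ⟨q, hq, hq'⟩ := h t (Nat.lt_succ_self t)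
      exact Set.mem_biUnion (x := c t)
        ⟨c, fun i hi => hc i (hi.trans t.le_succ), hp, rfl,
          fun i hi => h i (hi.trans t.lt_succ_self)⟩
        (Set.mem_biUnion (x := q) hq ⟨hc _ le_rfl, by simpa using hq'⟩)
  have hfin : ({{p}} ∪ ⋃ t ∈ Set.Iio n, ⋃ y ∈ R t, {z : Finset V | z ⊆ y}).Finite :=
    (Set.finite_singleton _).union ((Set.finite_Iio n).biUnion fun t _ => (hR t).biUnion fun y _ =>
      (y.powerset.finite_toSet).subset fun z hz => by simpa using hz)
  refine Set.Finite.of_finite_image (f := Subtype.val) (hfin.subset ?_)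
    Subtype.val_injective.injOn
  rintro _ ⟨y, hy, rfl⟩
  rcases hy with hy | ⟨t, c, ht, hc, hp, hy, h⟩
  · exact Or.inl hy.symm
  · exact Or.inr (Set.mem_biUnion (x := t) ht (Set.mem_biUnion (x := c t) ⟨c, hc, hp, rfl, h⟩ hy))

end Balls

section GroupAction

variable {V : Type v} {K : AbstractSimplicialComplex V} {G : Type u} [Group G] [MulAction G V]

theorem cellSMul_singleton (g : G) (p : V) : cellSMul g {p} = {g • p} := by
  simp [cellSMul]

theorem cellSMul_subset_cellSMul {g : G} {x y : Finset V} (h : x ⊆ y) :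
    cellSMul g x ⊆ cellSMul g y := Finset.map_subset_map.2 h

theorem CellDistLE.smul (hK : ∀ (g : G), ∀ x ∈ K, cellSMul g x ∈ K) (g : G) {x y : Finset V} {n : ℕ}
    (h : CellDistLE K x y n) : CellDistLE K (cellSMul g x) (cellSMul g y) n := by
  rcases h with rfl | ⟨t, c, ht, hc, hx, hy, h⟩
  · exact Or.inl rfl
  · refine Or.inr ⟨t, fun i => cellSMul g (c i), ht, fun i hi => hK g _ (hc i hi),
      cellSMul_subset_cellSMul hx, cellSMul_subset_cellSMul hy, fun i hi => ?_⟩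
    obtain ⟨q, hq, hq'⟩ := h i hi
    exact ⟨g • q, by rwa [mem_cellSMul, inv_smul_smul], by rwa [mem_cellSMul, inv_smul_smul]⟩

/-- If the quotient map of a connected complex by `Γ` is a cover map, then an element of `Γ` that
fixes a vertex fixes all vertices: it permutes the cells at that vertex over the quotient, and thus
fixes them. -/
theorem IsCoverSubgroup.smul_eq (hK : IsConnectedComplex K) {Γ : Subgroup G}
    (hKG : ∀ (g : G), ∀ x ∈ K, cellSMul g x ∈ K)
    (hΓ : IsCoverSubgroup K Γ) {γ : G} (hγ : γ ∈ Γ) {p : V} (hp : γ • p = p) (q : V) :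
    γ • q = q := by
  classical
  obtain ⟨W, L, f, hf, hfΓ⟩ := hΓ
  have himg : ∀ x ∈ K, (cellSMul γ x).image f = x.image f := fun x hx => by
    apply Finset.Subset.antisymm
    · exact (hfΓ _ (hKG γ x hx) x hx).2 ⟨γ⁻¹, Γ.inv_mem hγ, by
        rw [← cellSMul_mul, inv_mul_cancel, cellSMul_one]⟩
    · exact (hfΓ _ hx _ (hKG γ x hx)).2 ⟨γ, hγ, Finset.Subset.rfl⟩
  have hstar : ∀ c ∈ K, ∀ r ∈ c, γ • r = r → ∀ s ∈ c, γ • s = s := by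
    intro c hc r hr hγr s hs
    have h1 : cellSMul γ c = c := by
      refine (hf.bijOn_star r).injOn ⟨hKG γ c hc, ?_⟩ ⟨hc, hr⟩ (himg c hc)
      rw [mem_cellSMul, ← hγr, inv_smul_smul]
      exact hr
    have h2 : γ • s ∈ c := by
      rw [← h1, mem_cellSMul, inv_smul_smul]
      exact hs
    refine hf.injOn c hc h2 hs ?_
    have h3 := himg {s} (K.singleton_mem s)
    rw [cellSMul_singleton, Finset.image_singleton, Finset.image_singleton] at h3
    exact Finset.singleton_injective h3
  obtain ⟨n, h | ⟨t, c, -, hc, hx, hy, h⟩⟩ := hK.2 _ (K.singleton_mem p) _ (K.singleton_mem q)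
  · rwa [← Finset.singleton_injective h]
  · have hall : ∀ i ≤ t, ∀ s ∈ c i, γ • s = s := by
      intro i
      induction i with
      | zero => exact fun h0 => hstar _ (hc 0 h0) p (by simpa using hx) hp
      | succ i ih =>
        intro hi
        obtain ⟨r, hr, hr'⟩ := h i hi
        exact hstar _ (hc _ hi) r hr' (ih (Nat.le_of_succ_le hi) r hr)
    exact hall t le_rfl q (by simpa using hy)

variable [TopologicalSpace G] [IsTopologicalGroup G]

theorem IsGComplex.isCompact_setOf_cellSMul_eq (hK : IsGComplex G K) {x y : Finset V}
    (hx : x ∈ K) : IsCompact {g : G | cellSMul g x = y} := by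
  by_cases h : ∃ g₀ : G, cellSMul g₀ x = y
  · obtain ⟨g₀, rfl⟩ := h
    have h1 : {g : G | cellSMul g x = cellSMul g₀ x} =
        (fun g => g₀ * g) '' {g : G | cellSMul g x = x} := by
      ext g
      constructor
      · intro hg
        refine ⟨g₀⁻¹ * g, ?_, mul_inv_cancel_left _ _⟩
        change cellSMul (g₀⁻¹ * g) x = x
        rw [cellSMul_mul, show cellSMul g x = _ from hg, ← cellSMul_mul, inv_mul_cancel,
          cellSMul_one]
      · rintro ⟨k, hk, rfl⟩
        change cellSMul (g₀ * k) x = _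
        rw [cellSMul_mul, show cellSMul k x = x from hk]
    rw [h1]
    exact (hK.isCompact_stabilizer x hx).image (continuous_const_mul g₀)
  · have h1 : {g : G | cellSMul g x = y} = ∅ :=
      Set.eq_empty_of_forall_notMem fun g hg => h ⟨g, hg⟩
    rw [h1]
    exact isCompact_empty

theorem AvoidsCompactSets.injectsOnBalls (hK : IsGComplex G K) {ι : Type w} {Γ : ι → Subgroup G}
    (h : AvoidsCompactSets Γ) : InjectsOnBalls K Γ := by
  intro n
  obtain ⟨p⟩ := hK.connected.1
  let B := vertexBall K p n
  have hB : B.Finite := hK.locallyFinite.finite_vertexBall p n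
  obtain ⟨α, g, hg⟩ := h (⋃ x ∈ B, ⋃ y ∈ B, {k : G | cellSMul k x.1 = y.1})
    (hB.isCompact_biUnion fun x _ => hB.isCompact_biUnion fun y _ =>
      hK.isCompact_setOf_cellSMul_eq x.2)
    (by
      have h1 : (⟨{p}, K.singleton_mem p⟩ : K) ∈ B := Or.inl rfl
      exact Set.mem_biUnion h1 (Set.mem_biUnion h1 (cellSMul_one _)))
  have hball : ∀ x ∈ vertexBall K (g • p) n,
      (⟨cellSMul g⁻¹ x.1, hK.smul_mem _ _ x.2⟩ : K) ∈ B := fun x hx => by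
    have h1 := CellDistLE.smul hK.smul_mem g⁻¹ hx
    rwa [cellSMul_singleton, inv_smul_smul] at h1
  refine ⟨α, g • p, fun x hx y hy hxy => ?_⟩
  obtain ⟨γ, hγ, hγxy⟩ : ∃ γ ∈ Γ α, cellSMul γ x.1 = y.1 := Quotient.exact hxy
  have h1 : cellSMul (g⁻¹ * γ * g) (cellSMul g⁻¹ x.1) = cellSMul g⁻¹ y.1 := by
    rw [← cellSMul_mul, mul_inv_cancel_right, cellSMul_mul, hγxy]
  have h2 : g⁻¹ * γ * g ∈ ({1} : Set G) := by
    rw [← hg]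
    exact ⟨Set.mem_biUnion (hball x hx) (Set.mem_biUnion (hball y hy) h1), γ, hγ, rfl⟩
  rw [Set.mem_singleton_iff.1 h2, cellSMul_one] at h1
  have h3 := congrArg (cellSMul g) h1
  rw [← cellSMul_mul, ← cellSMul_mul, mul_inv_cancel, cellSMul_one, cellSMul_one] at h3
  exact Subtype.ext h3

/-- The translates of a vertex by a compact set have bounded distance from it. -/
theorem IsGComplex.exists_cellDistLE (hK : IsGComplex G K) {C : Set G} (hC : IsCompact C) (p : V) :
    ∃ n, ∀ c ∈ C, CellDistLE K {p} {c • p} n := by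
  obtain ⟨t, -, ht⟩ := hC.elim_nhds_subcover
    (fun c : G => (fun g => c⁻¹ * g) ⁻¹' {g : G | cellSMul g ({p} : Finset V) = {p}})
    (fun c _ => ((hK.isOpen_stabilizer _ (K.singleton_mem p)).preimage
      (continuous_const_mul c⁻¹)).mem_nhds (by
        change cellSMul (c⁻¹ * c) _ = _
        rw [inv_mul_cancel, cellSMul_one]))
  choose n hn using fun c : G => hK.connected.2 _ (K.singleton_mem p) _ (K.singleton_mem (c • p))
  refine ⟨t.sup n, fun c hc => ?_⟩
  obtain ⟨c', hc', h⟩ := Set.mem_iUnion₂.1 (ht hc)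
  have h1 : (c'⁻¹ * c) • p = p := by
    have : cellSMul (c'⁻¹ * c) ({p} : Finset V) = {p} := h
    rw [cellSMul_singleton] at this
    exact Finset.singleton_injective this
  have h2 : c • p = c' • p := by
    rw [mul_smul, inv_smul_eq_iff] at h1
    exact h1
  rw [h2]
  exact (hn c').mono (Finset.le_sup hc')

theorem InjectsOnBalls.avoidsCompactSets (hK : IsGComplex G K) (hfin : IsAlmostTransitive G K)
    {ι : Type w} {Γ : ι → Subgroup G} (hΓ : ∀ α, IsCoverSubgroup K (Γ α))
    (h : InjectsOnBalls K Γ) : AvoidsCompactSets Γ := by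
  intro C hC h1C
  have : Finite (Quotient (cellOrbitRel K (⊤ : Subgroup G))) := hfin
  let cls : V → Quotient (cellOrbitRel K (⊤ : Subgroup G)) :=
    fun p => Quotient.mk _ ⟨{p}, K.singleton_mem p⟩
  -- One radius works for one representative of each of the finitely many orbits of vertices.
  obtain ⟨N, hN⟩ : ∃ N, ∀ p, ∃ p₀, cls p₀ = cls p ∧ ∀ c ∈ C, CellDistLE K {p₀} {c • p₀} N := by
    choose n hn using fun p : V => hK.exists_cellDistLE hC p
    obtain ⟨N, hN⟩ := (Set.finite_range fun q : Set.range cls => n q.2.choose).bddAbove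
    refine ⟨N, fun p => ⟨(⟨p, rfl⟩ : ∃ q, cls q = cls p).choose,
      (⟨p, rfl⟩ : ∃ q, cls q = cls p).choose_spec, fun c hc => (hn _ c hc).mono ?_⟩⟩
    exact hN ⟨⟨cls p, p, rfl⟩, rfl⟩
  obtain ⟨α, p, hp⟩ := h N
  obtain ⟨p₀, hp₀, hC₀⟩ := hN p
  obtain ⟨g, -, hg⟩ : ∃ g ∈ (⊤ : Subgroup G), cellSMul g ({p₀} : Finset V) = {p} :=
    Quotient.exact hp₀
  rw [cellSMul_singleton] at hg
  have hg' : g • p₀ = p := Finset.singleton_injective hg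
  refine ⟨α, g, Set.Subset.antisymm ?_ ?_⟩
  · rintro _ ⟨hc, γ, hγ, rfl⟩
    have h1 := CellDistLE.smul hK.smul_mem g (hC₀ _ hc)
    rw [cellSMul_singleton, cellSMul_singleton, hg', ← mul_smul, ← mul_assoc,
      mul_inv_cancel_left, mul_smul, hg'] at h1
    have h2 : (⟨{p}, K.singleton_mem p⟩ : K) = ⟨{γ • p}, K.singleton_mem _⟩ :=
      hp (Or.inl rfl) h1 (Quotient.sound ⟨γ, hγ, cellSMul_singleton γ p⟩)
    have h3 : γ • p = p := (Finset.singleton_injective (congrArg Subtype.val h2)).symm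
    have h4 : γ = 1 := hK.faithful.eq_of_smul_eq_smul fun q => by
      rw [(hΓ α).smul_eq hK.connected hK.smul_mem hγ h3, one_smul]
    rw [Set.mem_singleton_iff, h4]
    simp
  · rintro _ rfl
    exact ⟨h1C, 1, (Γ α).one_mem, by simp⟩

end GroupAction

/-! ### Operators on finitely supported functions -/

namespace PHil

variable {X Y : Type u}

theorem inner_ell2 (φ ψ : ell2 X) :
    inner ℂ φ ψ = Finsupp.sum (show X →₀ ℂ from φ) fun x c => star c * (show X →₀ ℂ from ψ) x :=
  rfl

theorem norm_ell2_sq (φ : X →₀ ℂ) :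
    ‖(show ell2 X from φ)‖ ^ 2 = ∑ x ∈ φ.support, ‖φ x‖ ^ 2 := by
  have h : (inner ℂ (show ell2 X from φ) (show ell2 X from φ)).re = ∑ x ∈ φ.support, ‖φ x‖ ^ 2 := by
    rw [inner_ell2]
    simp only [Finsupp.sum, Complex.re_sum]
    refine Finset.sum_congr rfl fun x _ => ?_
    rw [RCLike.star_def, Complex.conj_mul', ← Complex.ofReal_pow, Complex.ofReal_re]
  rw [← h, ← inner_self_eq_norm_sq (𝕜 := ℂ)]
  rfl

theorem inner_single_left (x : X) (ψ : X →₀ ℂ) :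
    inner ℂ (show ell2 X from Finsupp.single x 1) (show ell2 X from ψ) = ψ x := by
  rw [inner_ell2]
  refine (Finsupp.sum_single_index (by simp)).trans ?_
  simp

theorem inner_single_right (x : X) (ψ : X →₀ ℂ) :
    inner ℂ (show ell2 X from ψ) (show ell2 X from Finsupp.single x 1) = star (ψ x) := by
  rw [← inner_single_left x ψ]
  exact (inner_conj_symm _ _).symm

/-- The `ℓ¹`-norm of a finitely supported function. -/
def l1Norm (φ : X →₀ ℂ) : ℝ := ∑ x ∈ φ.support, ‖φ x‖

theorem sum_norm_le_l1Norm (φ : X →₀ ℂ) (s : Finset X) : ∑ x ∈ s, ‖φ x‖ ≤ l1Norm φ := by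
  classical
  calc ∑ x ∈ s, ‖φ x‖ ≤ ∑ x ∈ s ∪ φ.support, ‖φ x‖ :=
        Finset.sum_le_sum_of_subset_of_nonneg Finset.subset_union_left fun _ _ _ => norm_nonneg _
    _ = l1Norm φ := (Finset.sum_subset Finset.subset_union_right fun x _ hx => by
        rw [Finsupp.notMem_support_iff.1 hx, norm_zero]).symm

theorem l1Norm_mapDomain_le (f : X → Y) (φ : X →₀ ℂ) : l1Norm (φ.mapDomain f) ≤ l1Norm φ := by
  classical
  have h : ∀ y, ‖φ.mapDomain f y‖ ≤ ∑ x ∈ φ.support with f x = y, ‖φ x‖ := by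
    intro y
    rw [Finsupp.mapDomain, Finsupp.sum_apply, Finsupp.sum, Finset.sum_filter]
    refine (norm_sum_le _ _).trans (Finset.sum_le_sum fun x _ => ?_)
    rw [Finsupp.single_apply]
    split_ifs <;> simp
  calc l1Norm (φ.mapDomain f)
      ≤ ∑ y ∈ φ.support.image f, ‖φ.mapDomain f y‖ :=
        Finset.sum_le_sum_of_subset_of_nonneg Finsupp.mapDomain_support fun _ _ _ => norm_nonneg _
    _ ≤ ∑ y ∈ φ.support.image f, ∑ x ∈ φ.support with f x = y, ‖φ x‖ :=
        Finset.sum_le_sum fun y _ => h y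
    _ = l1Norm φ := Finset.sum_fiberwise_of_maps_to
        (fun x hx => Finset.mem_image_of_mem f hx) _

/-- The **Schur test**: an operator whose matrix has rows and columns of `ℓ¹`-norm at most `M` has
norm at most `M`. The rows are the columns of the dual operator. -/
theorem norm_le_of_l1Norm_le {T T' : Module.End ℂ (ell2 X)}
    (hT : ∀ φ ψ, inner ℂ (T φ) ψ = inner ℂ φ (T' ψ)) {M : ℝ} (hM : 0 < M)
    (h : ∀ x : X, l1Norm (T (Finsupp.single x 1 : X →₀ ℂ)) ≤ M)
    (h' : ∀ x : X, l1Norm (T' (Finsupp.single x 1 : X →₀ ℂ)) ≤ M) (φ : ell2 X) :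
    ‖T φ‖ ≤ M * ‖φ‖ := by
  let t : X → X → ℂ := fun x y => (show X →₀ ℂ from T (Finsupp.single y 1 : X →₀ ℂ)) x
  let φ' : X →₀ ℂ := φ
  let ψ : X →₀ ℂ := T φ
  -- The entries of a row are, up to conjugation, those of a column of the dual operator.
  have ht' : ∀ x y, ‖(show X →₀ ℂ from T' (Finsupp.single x 1 : X →₀ ℂ)) y‖ = ‖t x y‖ := by
    intro x y
    rw [← inner_single_left y]
    have h1 := hT (Finsupp.single y 1 : X →₀ ℂ) (Finsupp.single x 1 : X →₀ ℂ)
    refine (congrArg norm h1.symm).trans ((congrArg norm (inner_single_right x _)).trans ?_)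
    rw [norm_star]
  have hψ : ∀ x, ψ x = ∑ y ∈ φ'.support, φ' y * t x y := by
    intro x
    have h1 : φ = ∑ y ∈ φ'.support, φ' y • (show ell2 X from (Finsupp.single y 1 : X →₀ ℂ)) := by
      have h2 : φ' = ∑ y ∈ φ'.support, φ' y • (Finsupp.single y 1 : X →₀ ℂ) := by
        conv_lhs => rw [← Finsupp.sum_single φ']
        simp [Finsupp.sum]
      exact h2
    have h3 : ψ = ∑ y ∈ φ'.support, φ' y • (show X →₀ ℂ from T (Finsupp.single y 1 : X →₀ ℂ)) := by
      change T φ = _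
      conv_lhs => rw [h1]
      rw [map_sum]
      exact Finset.sum_congr rfl fun y _ => map_smul T _ _
    rw [h3, Finsupp.finsetSum_apply]
    rfl
  have hcol : ∀ y, ∑ x ∈ ψ.support, ‖t x y‖ ≤ M := fun y =>
    (sum_norm_le_l1Norm _ _).trans (h y)
  have hrow : ∀ x, ∑ y ∈ φ'.support, ‖t x y‖ ≤ M := fun x => by
    simp only [← ht']
    exact (sum_norm_le_l1Norm _ _).trans (h' x)
  -- The weights in `M |ψ x| |φ y| ≤ (|ψ x|² + M² |φ y|²) / 2` are chosen such that one half of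
  -- `‖ψ‖²` is absorbed by the left-hand side.
  have h1 : M * ∑ x ∈ ψ.support, ‖ψ x‖ ^ 2 ≤
      ∑ x ∈ ψ.support, ∑ y ∈ φ'.support,
        (‖t x y‖ * (‖ψ x‖ ^ 2 / 2) + ‖t x y‖ * (M ^ 2 * ‖φ' y‖ ^ 2 / 2)) := by
    rw [Finset.mul_sum]
    refine Finset.sum_le_sum fun x _ => ?_
    have h2 : ‖ψ x‖ ≤ ∑ y ∈ φ'.support, ‖φ' y‖ * ‖t x y‖ := by
      rw [hψ]
      refine (norm_sum_le _ _).trans (Finset.sum_le_sum fun y _ => (norm_mul _ _).le)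
    calc M * ‖ψ x‖ ^ 2 = M * ‖ψ x‖ * ‖ψ x‖ := by ring
      _ ≤ M * ‖ψ x‖ * ∑ y ∈ φ'.support, ‖φ' y‖ * ‖t x y‖ :=
        mul_le_mul_of_nonneg_left h2 (by positivity)
      _ = ∑ y ∈ φ'.support, M * ‖ψ x‖ * (‖φ' y‖ * ‖t x y‖) := Finset.mul_sum _ _ _
      _ ≤ _ := Finset.sum_le_sum fun y _ => by
        have h3 := mul_nonneg (norm_nonneg (t x y)) (sq_nonneg (‖ψ x‖ - M * ‖φ' y‖))
        nlinarith
  have h2 : ∑ x ∈ ψ.support, ∑ y ∈ φ'.support,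
        (‖t x y‖ * (‖ψ x‖ ^ 2 / 2) + ‖t x y‖ * (M ^ 2 * ‖φ' y‖ ^ 2 / 2)) ≤
      M * ((∑ x ∈ ψ.support, ‖ψ x‖ ^ 2) / 2) +
        M * (M ^ 2 * (∑ y ∈ φ'.support, ‖φ' y‖ ^ 2) / 2) := by
    simp only [Finset.sum_add_distrib]
    refine add_le_add ?_ ?_
    · simp only [← Finset.sum_mul]
      rw [Finset.sum_div, Finset.mul_sum]
      exact Finset.sum_le_sum fun x _ => mul_le_mul_of_nonneg_right (hrow x) (by positivity)
    · rw [Finset.sum_comm]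
      simp only [← Finset.sum_mul]
      rw [Finset.mul_sum, Finset.sum_div, Finset.mul_sum]
      exact Finset.sum_le_sum fun x _ => mul_le_mul_of_nonneg_right (hcol x) (by positivity)
  have h3 : ‖T φ‖ ^ 2 = ∑ x ∈ ψ.support, ‖ψ x‖ ^ 2 := norm_ell2_sq ψ
  have h4 : ‖φ‖ ^ 2 = ∑ x ∈ φ'.support, ‖φ' x‖ ^ 2 := norm_ell2_sq φ'
  rw [← h3, ← h4] at h2
  rw [← h3] at h1
  rw [← sq_le_sq₀ (norm_nonneg _) (by positivity), mul_pow]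
  have h5 := h1.trans h2
  rw [← mul_add] at h5
  have h6 := le_of_mul_le_mul_left h5 hM
  linarith

theorem inner_mapDomain (f : X → Y) (φ ψ : X →₀ ℂ)
    (hf : Set.InjOn f (φ.support ∪ ψ.support : Set X)) :
    inner ℂ (show ell2 Y from φ.mapDomain f) (show ell2 Y from ψ.mapDomain f) =
      inner ℂ (show ell2 X from φ) (show ell2 X from ψ) := by
  classical
  have hφ : ∀ x ∈ φ.support, φ.mapDomain f (f x) = φ x := fun x hx =>
    Finsupp.mapDomain_apply' _ φ Set.subset_union_left hf (Or.inl hx)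
  have hψ : ∀ x ∈ φ.support, ψ.mapDomain f (f x) = ψ x := fun x hx =>
    Finsupp.mapDomain_apply' _ ψ Set.subset_union_right hf (Or.inl hx)
  rw [inner_ell2, inner_ell2]
  change ∑ y ∈ (φ.mapDomain f).support, star (φ.mapDomain f y) * ψ.mapDomain f y =
    ∑ x ∈ φ.support, star (φ x) * ψ x
  rw [Finsupp.mapDomain_support_of_injOn φ (hf.mono Set.subset_union_left),
    Finset.sum_image (hf.mono Set.subset_union_left)]
  exact Finset.sum_congr rfl fun x hx => by rw [hφ x hx, hψ x hx]

/-- The push-forward of finitely supported functions along a map. -/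
def push (f : X → Y) : ell2 X →ₗ[ℂ] ell2 Y := Finsupp.lmapDomain ℂ ℂ f

/-- The indicator function of a point. -/
def delta (x : X) : ell2 X := (Finsupp.single x 1 : X →₀ ℂ)

theorem push_delta (f : X → Y) (x : X) : push f (delta x) = delta (f x) := Finsupp.mapDomain_single

theorem l1Norm_push_le (f : X → Y) (φ : ell2 X) : l1Norm (push f φ) ≤ l1Norm φ :=
  l1Norm_mapDomain_le f φ

end PHil

/-! ### Semi-elementary functors -/

section SemiElementary

variable {V : Type v} {G : Type u} [Group G] [MulAction G V] {K : AbstractSimplicialComplex V}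

namespace GQuotient

/-- A presentation of the functor `F` as a direct summand of `ℓ² ∘ S`: natural isometric embeddings
`emb X : F X → ℓ²(S X)` whose adjoints `ret X` exist and are natural retractions. -/
structure EllTwoSummand (F : GQuotient G K ⥤ PHil.{u}) (S : GQuotient G K ⥤ Type u) where
  emb : ∀ X, F.obj X →ₗ[ℂ] PHil.ell2 (S.obj X)
  ret : ∀ X, PHil.ell2 (S.obj X) →ₗ[ℂ] F.obj X
  ret_emb : ∀ X x, ret X (emb X x) = x
  inner_emb : ∀ X x φ, inner ℂ (emb X x) φ = inner ℂ x (ret X φ)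
  emb_map : ∀ ⦃X Y⦄ (f : X ⟶ Y) x,
    emb Y (PHil.lin (F.map f) x) = PHil.push (S.map f) (emb X x)
  ret_map : ∀ ⦃X Y⦄ (f : X ⟶ Y) φ,
    ret Y (PHil.push (S.map f) φ) = PHil.lin (F.map f) (ret X φ)

variable {F : GQuotient G K ⥤ PHil.{u}} {S : GQuotient G K ⥤ Type u}

theorem EllTwoSummand.inner_emb_emb (J : EllTwoSummand F S) (X : GQuotient G K) (x y : F.obj X) :
    inner ℂ (J.emb X x) (J.emb X y) = inner ℂ x y := by
  rw [J.inner_emb, J.ret_emb]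

theorem EllTwoSummand.norm_emb (J : EllTwoSummand F S) (X : GQuotient G K) (x : F.obj X) :
    ‖J.emb X x‖ = ‖x‖ := by
  rw [← sq_eq_sq₀ (norm_nonneg _) (norm_nonneg _), ← inner_self_eq_norm_sq (𝕜 := ℂ),
    ← inner_self_eq_norm_sq (𝕜 := ℂ), J.inner_emb_emb]

/-- There are finitely many elements of `S K` whose images cover all the sets `S X`. -/
theorem exists_finite_generators (hb : ∀ X : GQuotient G K, Function.Bijective (orbitMap S X))
    [Finite (MulAction.orbitRel.Quotient G (BaseSet S))] :
    ∃ R : Set (BaseSet S), R.Finite ∧ ∀ (X : GQuotient G K) (y : S.obj X),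
      ∃ (f : base G K ⟶ X), ∃ x ∈ R, S.map f x = y := by
  refine ⟨Set.range fun q : MulAction.orbitRel.Quotient G (BaseSet S) => q.out,
    Set.finite_range _, fun X y => ?_⟩
  obtain ⟨q, rfl⟩ := (hb X).2 y
  induction q using Quotient.inductionOn with
  | h x =>
    let q : MulAction.orbitRel.Quotient G (BaseSet S) := Quotient.mk _ x
    obtain ⟨g, hg⟩ : ∃ g : G, g • q.out = x := by
      obtain ⟨g, hg⟩ := Quotient.exact (Quotient.out_eq q).symm
      exact ⟨g, hg⟩
    refine ⟨(base G K).projHom g ≫ X.projHom 1, q.out, ⟨q, rfl⟩, ?_⟩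
    change _ = S.map (X.projHom 1) x
    rw [← hg, base_smul_def, S.map_comp]
    rfl

/-- An operator family on a semi-elementary functor has a bound on the norm that is uniform over
all quotients: the columns of its matrix over `Γ \ K` are images of the columns over `K`, of
which there are finitely many up to the action of `G`. -/
theorem EllTwoSummand.exists_bound (J : EllTwoSummand F S)
    (hb : ∀ X : GQuotient G K, Function.Bijective (orbitMap S X))
    [Finite (MulAction.orbitRel.Quotient G (BaseSet S))] (a : Op F) :
    ∃ M : ℝ, ∀ (X : GQuotient G K) (x : F.obj X), ‖a.app X x‖ ≤ M * ‖x‖ := by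
  obtain ⟨R, hR, hRS⟩ := exists_finite_generators hb
  let T : Op F → ∀ X, Module.End ℂ (PHil.ell2 (S.obj X)) :=
    fun b X => J.emb X ∘ₗ b.app X ∘ₗ J.ret X
  have hnat : ∀ (b : Op F) ⦃X Y⦄ (f : X ⟶ Y) φ,
      PHil.push (S.map f) (T b X φ) =
        T b Y (PHil.push (S.map f) φ) := by
    intro b X Y f φ
    change PHil.push (S.map f) (J.emb X (b.app X (J.ret X φ))) =
      J.emb Y (b.app Y (J.ret Y (PHil.push (S.map f) φ)))
    rw [← J.emb_map, J.ret_map]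
    exact congrArg (J.emb Y) (b.2.1 f _)
  have hbd : ∀ b : Op F, ∃ M : ℝ, 0 < M ∧ ∀ X (y : S.obj X),
      PHil.l1Norm (T b X (PHil.delta y)) ≤ M := by
    intro b
    obtain ⟨M, hM⟩ := (hR.image fun x : BaseSet S =>
      PHil.l1Norm (T b (base G K) (PHil.delta x))).bddAbove
    refine ⟨max M 1, by positivity, fun X y => ?_⟩
    obtain ⟨f, x, hx, rfl⟩ := hRS X y
    have h1 : T b X (PHil.delta (S.map f x)) =
        PHil.push (S.map f) (T b (base G K) (PHil.delta x)) :=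
      (congrArg (T b X) (PHil.push_delta _ _).symm).trans (hnat b f _).symm
    refine (congrArg PHil.l1Norm h1).trans_le ?_
    exact (PHil.l1Norm_push_le _ _).trans
      ((hM (Set.mem_image_of_mem _ hx)).trans (le_max_left _ _))
  obtain ⟨M, hM, hM'⟩ := hbd a
  obtain ⟨N, hN, hN'⟩ := hbd (star a)
  refine ⟨max M N, fun X x => ?_⟩
  have h1 := PHil.norm_le_of_l1Norm_le (T := T a X) (T' := T (star a) X) (fun φ ψ => by
    change inner ℂ (J.emb X (a.app X (J.ret X φ))) ψ =
      inner ℂ φ (J.emb X ((star a).app X (J.ret X ψ)))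
    rw [J.inner_emb, a.inner_app, ← inner_conj_symm φ, J.inner_emb, inner_conj_symm])
    (lt_max_of_lt_left hM) (fun y => (hM' X y).trans (le_max_left _ _))
    (fun y => (hN' X y).trans (le_max_right _ _)) (J.emb X x)
  have h2 : T a X (J.emb X x) = J.emb X (a.app X x) := by
    change J.emb X (a.app X (J.ret X (J.emb X x))) = _
    rw [J.ret_emb]
  rwa [h2, J.norm_emb, J.norm_emb] at h1

theorem IsSemiElementary.exists_ellTwoSummand [TopologicalSpace G] {F : GQuotient G K ⥤ PHil.{u}}
    (hF : IsSemiElementary F) :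
    ∃ S : GQuotient G K ⥤ Type u, Nonempty (EllTwoSummand F S) ∧
      (∀ x : BaseSet S, IsCompact (MulAction.stabilizer G x : Set G)) ∧
      (∀ X : GQuotient G K, Function.Bijective (orbitMap S X)) ∧
      Finite (MulAction.orbitRel.Quotient G (BaseSet S)) := by
  obtain ⟨F', S, ⟨i, hi⟩, hS, hb, hfin⟩ := hF
  have hinv : ∀ X x, PHil.lin (i.hom.app X) (PHil.lin (i.inv.app X) x) = x := fun X x =>
    congrArg (fun f : (PHil.sumFunctor F F').obj X ⟶ _ => PHil.lin f x) (i.inv_hom_id_app X)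
  have hnat : ∀ ⦃X Y⦄ (f : X ⟶ Y) φ, PHil.lin (i.hom.app Y)
      (PHil.push (S.map f) φ) =
      PHil.lin ((PHil.sumFunctor F F').map f) (PHil.lin (i.hom.app X) φ) := fun X Y f φ =>
    congrArg (fun k : (S ⋙ PHil.ell2Functor).obj X ⟶ _ => PHil.lin k φ) (i.hom.naturality f)
  have hnat' : ∀ ⦃X Y⦄ (f : X ⟶ Y) x, PHil.lin (i.inv.app Y)
      (PHil.lin ((PHil.sumFunctor F F').map f) x) =
      PHil.push (S.map f) (PHil.lin (i.inv.app X) x) := fun X Y f x =>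
    congrArg (fun k : (PHil.sumFunctor F F').obj X ⟶ _ => PHil.lin k x) (i.inv.naturality f)
  let inl : ∀ X, F.obj X →ₗ[ℂ] (PHil.sumFunctor F F').obj X := fun X =>
    (WithLp.linearEquiv 2 ℂ (F.obj X × F'.obj X)).symm.toLinearMap ∘ₗ
      LinearMap.inl ℂ (F.obj X) (F'.obj X)
  let fst : ∀ X, (PHil.sumFunctor F F').obj X →ₗ[ℂ] F.obj X := fun X =>
    LinearMap.fst ℂ (F.obj X) (F'.obj X) ∘ₗ
      (WithLp.linearEquiv 2 ℂ (F.obj X × F'.obj X)).toLinearMap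
  have hinl : ∀ ⦃X Y⦄ (f : X ⟶ Y) x, inl Y (PHil.lin (F.map f) x) =
      PHil.lin ((PHil.sumFunctor F F').map f) (inl X x) := fun X Y f x => by
    change WithLp.toLp 2 (PHil.lin (F.map f) x, (0 : F'.obj Y)) =
      WithLp.toLp 2 (PHil.lin (F.map f) x, PHil.lin (F'.map f) (0 : F'.obj X))
    rw [map_zero]
  refine ⟨S, ⟨{
    emb := fun X => PHil.lin (i.inv.app X) ∘ₗ inl X
    ret := fun X => fst X ∘ₗ PHil.lin (i.hom.app X)
    ret_emb := fun X x => ?_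
    inner_emb := fun X x φ => ?_
    emb_map := fun X Y f x => ?_
    ret_map := fun X Y f φ => ?_ }⟩, fun x => (hS x).1, hb, hfin⟩
  · change fst X (PHil.lin (i.hom.app X) (PHil.lin (i.inv.app X) (inl X x))) = x
    rw [hinv]
    rfl
  · change inner ℂ (PHil.lin (i.inv.app X) (inl X x)) φ =
      inner ℂ x (fst X (PHil.lin (i.hom.app X) φ))
    have h1 : ∀ z : WithLp 2 (F.obj X × F'.obj X),
        inner ℂ (WithLp.toLp 2 (x, (0 : F'.obj X))) z = inner ℂ x z.fst := fun z => by
      rw [WithLp.prod_inner_apply]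
      simp
    refine (hi X _ _).symm.trans ?_
    rw [hinv]
    exact h1 _
  · change PHil.lin (i.inv.app Y) (inl Y (PHil.lin (F.map f) x)) = _
    rw [hinl, hnat']
    rfl
  · change fst Y (PHil.lin (i.hom.app Y) _) = _
    rw [hnat]
    rfl

variable [TopologicalSpace G] [IsTopologicalGroup G]

/-- If the groups `Γ α` avoid compact sets, then finitely many coefficients of a vector of `F K`
are preserved by one of the morphisms `K → Γ α \ K`: it maps the finitely many points of `S K` that
support the vector and its images injectively. -/
theorem EllTwoSummand.exists_inner_map_eq (J : EllTwoSummand F S)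
    (hS : ∀ x : BaseSet S, IsCompact (MulAction.stabilizer G x : Set G))
    (hb : ∀ X : GQuotient G K, Function.Bijective (orbitMap S X))
    {ι : Type w} {Γ : ι → Subgroup G} (hΓ : ∀ α, IsCoverSubgroup K (Γ α))
    (h : AvoidsCompactSets Γ) (y : F.obj (base G K)) (s : Finset (Op F)) :
    ∃ (α : ι) (f : base G K ⟶ ⟨Γ α, hΓ α⟩), ∀ a ∈ s,
      inner ℂ (PHil.lin (F.map f) y) (a.app _ (PHil.lin (F.map f) y)) =
        inner ℂ y (a.app _ y) := by
  classical
  let supp : F.obj (base G K) → Finset (BaseSet S) := fun z =>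
    (show BaseSet S →₀ ℂ from J.emb _ z).support
  let Y : Finset (BaseSet S) := supp y ∪ s.biUnion fun a => supp (a.app _ y)
  have hcpt : ∀ x x' : BaseSet S, IsCompact {g : G | g • x = x'} := by
    intro x x'
    by_cases hx : ∃ g₀ : G, g₀ • x = x'
    · obtain ⟨g₀, rfl⟩ := hx
      have h1 : {g : G | g • x = g₀ • x} =
          (fun g => g₀ * g) '' (MulAction.stabilizer G x : Set G) := by
        ext g
        constructor
        · intro hg
          refine ⟨g₀⁻¹ * g, ?_, mul_inv_cancel_left _ _⟩
          change (g₀⁻¹ * g) • x = x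
          rw [mul_smul, show g • x = _ from hg, inv_smul_smul]
        · rintro ⟨k, hk, rfl⟩
          change (g₀ * k) • x = _
          rw [mul_smul, show k • x = x from hk]
      rw [h1]
      exact (hS x).image (continuous_const_mul g₀)
    · have h1 : {g : G | g • x = x'} = ∅ :=
        Set.eq_empty_of_forall_notMem fun g hg => hx ⟨g, hg⟩
      rw [h1]
      exact isCompact_empty
  obtain ⟨α, g, hg⟩ := h ({1} ∪ ⋃ x ∈ Y, ⋃ x' ∈ Y, {g : G | g • x = x'})
    (isCompact_singleton.union (Y.isCompact_biUnion fun x _ =>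
      Y.isCompact_biUnion fun x' _ => hcpt x x')) (Or.inl rfl)
  let X : GQuotient G K := ⟨Γ α, hΓ α⟩
  have hinj : Set.InjOn (fun x : BaseSet S => S.map (X.projHom g) x) Y := by
    intro x hx x' hx' hxx'
    have h1 : ∀ z : BaseSet S, S.map (X.projHom g) z = orbitMap S X (Quotient.mk _ (g • z)) := by
      intro z
      change _ = S.map (X.projHom 1) (S.map ((base G K).projHom g) z)
      have h2 := X.projHom_comp 1 g
      rw [one_mul] at h2
      rw [← h2, S.map_comp]
      rfl
    have h2 : S.map (X.projHom g) x = S.map (X.projHom g) x' := hxx'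
    rw [h1, h1] at h2
    obtain ⟨⟨γ, hγ⟩, hγx⟩ := Quotient.exact ((hb X).1 h2)
    have h3 : γ • g • x' = g • x := hγx
    have h4 : (g⁻¹ * γ * g) • x' = x := by
      rw [mul_smul, mul_smul, h3, inv_smul_smul]
    have h5 : g⁻¹ * γ * g ∈ ({1} : Set G) := by
      rw [← hg]
      exact ⟨Or.inr (Set.mem_biUnion hx' (Set.mem_biUnion hx h4)), γ, hγ, rfl⟩
    rw [Set.mem_singleton_iff.1 h5, one_smul] at h4
    exact h4.symm
  refine ⟨α, X.projHom g, fun a ha => ?_⟩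
  have h1 : a.app X (PHil.lin (F.map (X.projHom g)) y) =
      PHil.lin (F.map (X.projHom g)) (a.app _ y) := (a.2.1 _ y).symm
  refine (congrArg (inner ℂ _) h1).trans ?_
  rw [← J.inner_emb_emb, ← J.inner_emb_emb, J.emb_map, J.emb_map]
  refine PHil.inner_mapDomain (fun x : BaseSet S => S.map (X.projHom g) x) _ _ (hinj.mono ?_)
  refine Set.union_subset (fun x hx => ?_) fun x hx => ?_
  · exact Finset.mem_union_left _ hx
  · exact Finset.mem_union_right _ (Finset.mem_biUnion.2 ⟨a, ha, hx⟩)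

end GQuotient

end SemiElementary

/-! ### Spectra of quotients -/

section Spectra

theorem mem_closure_of_forall_finset {A : Type*} {χ : A → ℂ} {T : Set (A → ℂ)}
    (h : ∀ s : Finset A, ∃ η ∈ T, ∀ a ∈ s, η a = χ a) : χ ∈ closure T := by
  rw [mem_closure_iff_nhds]
  intro N hN
  rw [nhds_pi, Filter.mem_pi] at hN
  obtain ⟨I, hI, t, ht, htN⟩ := hN
  obtain ⟨η, hη, hηs⟩ := h hI.toFinset
  refine ⟨η, htN fun a ha => ?_, hη⟩
  rw [hηs a (hI.mem_toFinset.2 ha)]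
  exact mem_of_mem_nhds (ht a)

variable {C : Type u} [Category.{v} C] {F : C ⥤ PHil.{u}} {A : NonUnitalStarSubalgebra ℂ (Op F)}

theorem smoothRep_completion_coeff (hA : IsIdempotented A) (X : C) (hX : ActsContinuously A X)
    (y : (smoothRep A hA X hX).carrier) (a : A) :
    (smoothRep A hA X hX).completion.coeff
        (y : UniformSpace.Completion (smoothRep A hA X hX).carrier) a =
      inner ℂ (show smoothPart A X from y).1 (a.1.app X (show smoothPart A X from y).1) := by
  have h := UniformSpace.Completion.inner_coe (𝕜 := ℂ) y ((smoothRep A hA X hX).act a y)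
  rw [← (smoothRep A hA X hX).actC_coe] at h
  exact h

theorem smoothRep_completion_norm_act_le (hA : IsIdempotented A) (X : C)
    (hX : ActsContinuously A X) {a : A} {M : ℝ} (hM : ∀ y : F.obj X, ‖a.1.app X y‖ ≤ M * ‖y‖)
    (y : (smoothRep A hA X hX).completion.carrier) :
    ‖(smoothRep A hA X hX).completion.act a y‖ ≤ M * ‖y‖ := by
  refine UniformSpace.Completion.induction_on
    (p := fun y => ‖(smoothRep A hA X hX).actC a y‖ ≤ M * ‖y‖) y ?_ fun z => ?_
  · exact isClosed_le ((smoothRep A hA X hX).actC a).continuous.norm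
      (continuous_const.mul continuous_norm)
  · rw [PreUnitaryRep.actC_coe, UniformSpace.Completion.norm_coe, UniformSpace.Completion.norm_coe]
    exact hM (show smoothPart A X from z).1

theorem map_mem_smoothPart {X Y : C} (f : X ⟶ Y) {y : F.obj X} (hy : y ∈ smoothPart A X) :
    PHil.lin (F.map f) y ∈ smoothPart A Y := by
  induction hy using Submodule.span_induction with
  | mem y hy =>
    obtain ⟨a, ha, z, rfl⟩ := hy
    have h : PHil.lin (F.map f) (a.app X z) = a.app Y (PHil.lin (F.map f) z) := a.2.1 f z
    rw [h]
    exact apply_mem_smoothPart ha Y _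
  | zero => rw [map_zero]; exact Submodule.zero_mem _
  | add y z _ _ hy hz => rw [map_add]; exact Submodule.add_mem _ hy hz
  | smul c y _ hy => rw [map_smul]; exact Submodule.smul_mem _ c hy

/-- If every finite family of coefficients of a vector of `F X` is realized in one of the `F (Y i)`
by a morphism `X → Y i`, and `A` acts with uniform bounds, then the spectrum of `X` is in the
closure of the union of the spectra of the `Y i`. -/
theorem opSpec_subset_closure_iUnion (hA : IsIdempotented A) (hcont : ∀ X, ActsContinuously A X)
    (hbd : ∀ a : A, ∃ M : ℝ, ∀ (X : C) (x : F.obj X), ‖a.1.app X x‖ ≤ M * ‖x‖)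
    (X : C) {ι : Type w} (Y : ι → C)
    (h : ∀ (y : F.obj X) (s : Finset (Op F)), ∃ (i : ι) (f : X ⟶ Y i), ∀ a ∈ s,
      inner ℂ (PHil.lin (F.map f) y) (a.app _ (PHil.lin (F.map f) y)) = inner ℂ y (a.app _ y)) :
    opSpec A hA X (hcont X) ⊆ closure (⋃ i, opSpec A hA (Y i) (hcont (Y i))) := by
  classical
  rintro _ ⟨V, rfl, hV⟩
  choose M hM using hbd
  refine V.toDual_mem_closure_iUnion_spec hA
    (fun i => (smoothRep A hA (Y i) (hcont (Y i))).completion) M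
    (fun i a y => smoothRep_completion_norm_act_le hA (Y i) (hcont (Y i)) (hM a (Y i)) y)
    fun x hx => ?_
  let W := (smoothRep A hA X (hcont X)).completion
  have h1 : V.1.coeff x ∈ closure (Set.range W.coeff) := by
    refine closure_mono ?_ (UnitaryRep.weaklyContained_iff.1 hV x hx)
    rintro _ ⟨y, -, rfl⟩
    exact ⟨y, rfl⟩
  refine closure_minimal ?_ isClosed_closure h1
  rintro _ ⟨y, rfl⟩
  refine UniformSpace.Completion.induction_on
    (p := fun y => W.coeff y ∈ closure (⋃ i, Set.range
      (smoothRep A hA (Y i) (hcont (Y i))).completion.coeff)) y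
    (isClosed_closure.preimage W.continuous_coeff) fun z => ?_
  refine mem_closure_of_forall_finset fun s => ?_
  obtain ⟨i, f, hf⟩ := h (show smoothPart A X from z).1 (s.image Subtype.val)
  let z' : (smoothRep A hA (Y i) (hcont (Y i))).carrier :=
    (⟨_, map_mem_smoothPart f (show smoothPart A X from z).2⟩ : smoothPart A (Y i))
  refine ⟨_, Set.mem_iUnion.2 ⟨i, (z' : UniformSpace.Completion _), rfl⟩, fun a ha => ?_⟩
  rw [smoothRep_completion_coeff hA (Y i) (hcont (Y i)) z' a]
  exact (hf a.1 (Finset.mem_image_of_mem _ ha)).trans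
    (smoothRep_completion_coeff hA X (hcont X) z a).symm

end Spectra

end

theorem mainTheorem2 {G : Type u} [Group G] [TopologicalSpace G] [IsTopologicalGroup G]
    [T2Space G] [LocallyCompactSpace G] [TotallyDisconnectedSpace G]
    {V : Type v} [MulAction G V] (K : AbstractSimplicialComplex V)
    (hK : IsGComplex G K) (hfin : IsAlmostTransitive G K)
    (F : GQuotient G K ⥤ PHil.{u}) (hF : GQuotient.IsSemiElementary F)
    (A : NonUnitalStarSubalgebra ℂ (Op F)) (hA : IsIdempotented A)
    {ι : Type w} (Γ : ι → Subgroup G) (hΓ : ∀ α, IsCoverSubgroup K (Γ α)) :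
    (AvoidsCompactSets Γ ↔ InjectsOnBalls K Γ) ∧
    ∃ hcont : ∀ X : GQuotient G K, ActsContinuously A X,
      (AvoidsCompactSets Γ ∨ InjectsOnBalls K Γ) →
        opSpec A hA (GQuotient.base G K) (hcont _) ⊆
          closure (⋃ α, opSpec A hA ⟨Γ α, hΓ α⟩ (hcont _)) := by
  obtain ⟨S, ⟨J⟩, hS, hb, hS'⟩ := hF.exists_ellTwoSummand
  have hcont : ∀ X : GQuotient G K, ActsContinuously A X := fun X a _ =>
    (J.exists_bound hb a).imp fun M hM => hM X
  refine ⟨⟨fun h => h.injectsOnBalls hK, fun h => h.avoidsCompactSets hK hfin hΓ⟩, hcont,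
    fun h => ?_⟩
  have h' : AvoidsCompactSets Γ := h.elim id fun h => h.avoidsCompactSets hK hfin hΓ
  exact opSpec_subset_closure_iUnion hA hcont (fun a => J.exists_bound hb a.1) _ _
    fun y s => J.exists_inner_map_eq hS hb hΓ h' y s
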